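/- Let $r>0$. For a probability distribution $P$ on $\mathbb{R}$ with $\int |x|^r\,dP(x)<\infty$, an $L^r(P)$-optimal quantizer at level $n\ge 1$ is a nonempty set $\alpha_n\subset\mathbb{R}$ of at most $n$ points which minimizes $\big(\int_{\mathbb{R}} \min_{a\in\alpha}|x-a|^r\,dP(x)\big)^{1/r}$ among all nonempty sets $\alpha\subset\mathbb{R}$ of at most $n$ points; its maximal radius is $\rho_n=\max\{|a| : a\in\alpha_n\}$. (a) There is a real constant $C_r$ depending only on $r$ such that the following holds for every $\lambda>0$. Let $P$ be the exponential distribution with parameter $\lambda$ (density $\lambda e^{-\lambda x}\mathbf 1_{\{x\ge 0\}}$). Then for every $n\ge 1$ the $L^r(P)$-optimal quantizer $\alpha_n$ at level $n$ exists and is unique, and, as $n\to\infty$, $$\rho_n=\frac{r+1}{\lambda}\log n+\frac{C_r}{\lambda}+O\Big(\frac1n\Big).$$ (b) Let $\gamma>r$ and let $P$ be the Pareto distribution with index $\gamma$ (density $\gamma x^{-(\gamma+1)}\mathbf 1_{\{x>1\}}$). Then for every $n\ge 1$ the $L^r(P)$-optimal quantizer $\alpha_n$ at level $n$ exists and is unique,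 and there is a real constant $C_{r,\gamma}$, depending only on $r$ and $\gamma$, such that, as $n\to\infty$, $$\log\rho_n=\frac{r+1}{\gamma-r}\log n+C_{r,\gamma}+O\Big(\frac1n\Big).$$ -/

import Mathlib

open MeasureTheory ProbabilityTheory Filter Asymptotics
open scoped ENNReal NNReal

/-- The `L^r` quantization error `‖d(X, α)‖_r = (∫ d(x, α)^r dP(x))^{1/r}` (for `r > 0`) of the
finite grid `α`, for a random vector `X` with distribution `P`, with values in `[0, ∞]`. -/
noncomputable def quantizationError {E : Type*} [NormedAddCommGroup E] [MeasurableSpace E]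
    (r : ℝ) (P : Measure E) (α : Finset E) : ℝ≥0∞ :=
  eLpNorm (fun x : E => Metric.infDist x (α : Set E)) (ENNReal.ofReal r) P

/-- `α` is an `L^r(P)`-optimal quantizer at level `n`: a nonempty set of at most `n` points that
minimizes the `L^r` quantization error among all nonempty sets of at most `n` points. -/
def IsOptimalQuantizer {E : Type*} [NormedAddCommGroup E] [MeasurableSpace E]
    (r : ℝ) (P : Measure E) (n : ℕ) (α : Finset E) : Prop :=
  α.Nonempty ∧ α.card ≤ n ∧
    ∀ β : Finset E, β.Nonempty → β.card ≤ n → quantizationError r P α ≤ quantizationError r P β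

/-- The maximal radius `ρ(α) = max {|a| : a ∈ α}` of a (nonempty) quantizer `α`. -/
def maximalRadius {E : Type*} [NormedAddCommGroup E] (α : Finset E) : ℝ :=
  ((α.sup fun a => ‖a‖₊ : ℝ≥0) : ℝ)

/-! Both laws are affine images of `stretch κ S` with `S` standard exponential: `κ = 0` for the
exponential law and `κ = 1/γ` for the Pareto law. By `stretch_add` and the absence of memory, the
law beyond any threshold is an affine copy of the whole law. An optimal grid is therefore a first
point followed by an affine copy of the optimal grid with one point fewer.

Write `θ = 1 - κ r`. The optimal distortion always has the form `b ^ r / θ`, with `b` the first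
point of the grid. A tail of that distortion costs as much as the pointwise distance `exp (κ s) *
b`, so the choice of the cell boundary becomes a pointwise minimum. What remains is a one-variable
problem with a unique minimizer (`moment_sub_lt_of_ne`), whose value again has the form `b ^ r / θ`
(`rpow_eq_of_balance`). Induction on the level gives existence and uniqueness
(`IsGridParam.optimal`) and the recursion `IsGridParam` for the parameters `p`, `q`.

Both equations of the recursion equate values of one function at a small positive and a small
negative argument. Expanding at `0` gives `1 / p (n + 1) - 1 / p n = c + O(p n ^ 2)` with `c = 2 θ /
(r + 1)`, hence `p n` and `q n` are `1 / (c n) + O(1 / n ^ 2)`. The parameter of the largest point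
grows by `p (n + 1) + q n`, so it equals `(2 / c) log n + C + O(1 / n)`. For the exponential law the
radius is proportional to this parameter; for the Pareto law the logarithm of the radius is. -/

/-! ### The function `stretch` and its addition law. -/

/-- `stretch κ s = ∫₀ˢ exp (κ u) du`, that is `s` if `κ = 0` and `(exp (κ s) - 1) / κ` otherwise.
If `s` is exponentially distributed, `stretch κ s` is a generalized Pareto variable. -/
noncomputable def stretch (κ s : ℝ) : ℝ := ∫ u in (0 : ℝ)..s, Real.exp (κ * u)

theorem stretch_zero_left (s : ℝ) : stretch 0 s = s := by simp [stretch]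

@[simp] theorem stretch_zero (κ : ℝ) : stretch κ 0 = 0 := by simp [stretch]

theorem hasDerivAt_stretch (κ s : ℝ) : HasDerivAt (stretch κ) (Real.exp (κ * s)) s := by
  have hc : Continuous fun u : ℝ => Real.exp (κ * u) := by fun_prop
  exact intervalIntegral.integral_hasDerivAt_right (hc.intervalIntegrable _ _)
    (hc.stronglyMeasurableAtFilter _ _) hc.continuousAt

theorem one_add_mul_stretch (κ s : ℝ) : 1 + κ * stretch κ s = Real.exp (κ * s) := by
  have h : ∀ u ∈ Set.uIcc 0 s, HasDerivAt (fun u => Real.exp (κ * u)) (κ * Real.exp (κ * u)) u := by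
    intro u _
    have := ((hasDerivAt_id u).const_mul κ).exp
    simpa [mul_comm] using this
  have hc : Continuous fun u : ℝ => κ * Real.exp (κ * u) := by fun_prop
  have := intervalIntegral.integral_eq_sub_of_hasDerivAt h (hc.intervalIntegrable _ _)
  rw [intervalIntegral.integral_const_mul] at this
  rw [stretch, this]
  simp

@[fun_prop]
theorem continuous_stretch (κ : ℝ) : Continuous (stretch κ) :=
  continuous_iff_continuousAt.2 fun s => (hasDerivAt_stretch κ s).continuousAt

theorem strictMono_stretch (κ : ℝ) : StrictMono (stretch κ) :=
  strictMono_of_hasDerivAt_pos (fun s => hasDerivAt_stretch κ s) fun _ => Real.exp_pos _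

theorem stretch_pos {κ s : ℝ} (hs : 0 < s) : 0 < stretch κ s := by
  simpa using strictMono_stretch κ hs

theorem stretch_nonneg {κ s : ℝ} (hs : 0 ≤ s) : 0 ≤ stretch κ s := by
  simpa using (strictMono_stretch κ).monotone hs

/-- The source of all self-similarity: moving the origin to the parameter `s` acts on values as an
affine map of slope `exp (κ * s)`. -/
theorem stretch_add (κ s t : ℝ) :
    stretch κ (s + t) = stretch κ s + Real.exp (κ * s) * stretch κ t := by
  have hc : Continuous fun u : ℝ => Real.exp (κ * u) := by fun_prop
  have h := intervalIntegral.integral_comp_add_left (a := 0) (b := t)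
    (fun u : ℝ => Real.exp (κ * u)) s
  simp only [mul_add, Real.exp_add, intervalIntegral.integral_const_mul, add_zero] at h
  simp only [stretch]
  rw [h, intervalIntegral.integral_add_adjacent_intervals] <;> exact hc.intervalIntegrable _ _

theorem stretch_neg (κ s : ℝ) : stretch κ (-s) = -(Real.exp (-(κ * s)) * stretch κ s) := by
  have := stretch_add κ s (-s)
  rw [add_neg_cancel, stretch_zero] at this
  have h2 : Real.exp (-(κ * s)) * Real.exp (κ * s) = 1 := by rw [← Real.exp_add]; simp
  linear_combination (-Real.exp (-(κ * s))) * this - stretch κ (-s) * h2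

theorem stretch_eq (κ s : ℝ) : stretch κ s = -(Real.exp (κ * s) * stretch κ (-s)) := by
  have := stretch_neg κ (-s)
  simpa using this

theorem le_stretch {κ s : ℝ} (hκ : 0 ≤ κ) (hs : 0 ≤ s) : s ≤ stretch κ s := by
  have : ∫ u in (0 : ℝ)..s, (1 : ℝ) ≤ stretch κ s := by
    refine intervalIntegral.integral_mono_on hs (by simp)
      ((by fun_prop : Continuous fun u : ℝ => Real.exp (κ * u)).intervalIntegrable _ _) ?_
    intro u hu
    exact Real.one_le_exp (mul_nonneg hκ hu.1)
  simpa using this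

theorem stretch_le {κ s : ℝ} (hκ : 0 ≤ κ) (hs : 0 ≤ s) : stretch κ s ≤ s * Real.exp (κ * s) := by
  have : stretch κ s ≤ ∫ u in (0 : ℝ)..s, Real.exp (κ * s) := by
    refine intervalIntegral.integral_mono_on hs
      ((by fun_prop : Continuous fun u : ℝ => Real.exp (κ * u)).intervalIntegrable _ _) (by simp) ?_
    intro u hu
    exact Real.exp_le_exp.2 (mul_le_mul_of_nonneg_left hu.2 hκ)
  simpa using this

theorem tendsto_stretch_atTop {κ : ℝ} (hκ : 0 ≤ κ) : Tendsto (stretch κ) atTop atTop :=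
  tendsto_atTop_mono' _ ((eventually_ge_atTop 0).mono fun _ h => le_stretch hκ h) tendsto_id

theorem exists_stretch_eq {κ y : ℝ} (hκ : 0 ≤ κ) (hy : 0 ≤ y) : ∃ s, 0 ≤ s ∧ stretch κ s = y := by
  obtain ⟨s, hs, h⟩ := (tendsto_stretch_atTop hκ).eventually_ge_atTop y |>.and
    (eventually_ge_atTop 0) |>.exists.imp fun s hs =>
      (⟨hs.1, hs.2⟩ : y ≤ stretch κ s ∧ 0 ≤ s)
  obtain ⟨t, ht, h'⟩ := intermediate_value_Icc h (continuous_stretch κ).continuousOn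
    (show y ∈ Set.Icc (stretch κ 0) (stretch κ s) from ⟨by simpa using hy, hs⟩)
  exact ⟨t, ht.1, h'⟩

/-- The reflected map `q ↦ -stretch κ (-q)` takes every value `b ≥ 0` with `κ b < 1`. -/
theorem exists_neg_stretch_neg_eq {κ b : ℝ} (hκ : 0 ≤ κ) (hb : 0 ≤ b) (h : κ * b < 1) :
    ∃ q, 0 ≤ q ∧ -stretch κ (-q) = b := by
  rcases hκ.eq_or_lt with rfl | hκ
  · exact ⟨b, hb, by simp [stretch_zero_left]⟩
  · refine ⟨-(Real.log (1 - κ * b) / κ), ?_, ?_⟩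
    · rw [neg_nonneg]
      refine div_nonpos_of_nonpos_of_nonneg (Real.log_nonpos ?_ ?_) hκ.le
      · linarith
      · nlinarith
    · have := one_add_mul_stretch κ (Real.log (1 - κ * b) / κ)
      rw [mul_div_cancel₀ _ hκ.ne', Real.exp_log (by linarith)] at this
      rw [neg_neg]
      have h2 : κ * (-stretch κ (Real.log (1 - κ * b) / κ)) = κ * b := by linarith
      exact mul_left_cancel₀ hκ.ne' h2

/-! ### Tail integrals and the one-variable minimization over the first point. -/

section Integrals

variable {κ r : ℝ}

theorem integrableOn_stretch_add_rpow (hκ : 0 ≤ κ) (hr : 0 < r) (hκr : κ * r < 1) {c : ℝ}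
    (hc : 0 ≤ c) :
    IntegrableOn (fun s => (stretch κ s + c) ^ r * Real.exp (-s)) (Set.Ioi 0) := by
  -- With this `ε` the exponent `(κ + ε) r - 1` is `-(1 - κ r) / 2`, still negative; the surplus `ε`
  -- absorbs the linear factor in `stretch κ s ≤ s * exp (κ s)`.
  set ε := (1 - κ * r) / (2 * r) with hε
  have hε0 : 0 < ε := div_pos (by linarith) (by linarith)
  have hεr : ε * r = (1 - κ * r) / 2 := by rw [hε]; field_simp
  have hδ : 0 < (1 - κ * r) / 2 := by linarith
  have hdom := (exp_neg_integrableOn_Ioi 0 hδ).const_mul ((1 / ε + c) ^ r)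
  refine hdom.mono' ?_ ?_
  · exact (((continuous_stretch κ).add continuous_const).rpow_const
      (fun _ => Or.inr hr.le) |>.mul (by fun_prop)).aestronglyMeasurable
  · refine (ae_restrict_mem measurableSet_Ioi).mono fun s hs => ?_
    have hs : 0 < s := hs
    have hE := stretch_nonneg (κ := κ) hs.le
    rw [Real.norm_of_nonneg (mul_nonneg (Real.rpow_nonneg (by linarith) _) (Real.exp_pos _).le)]
    have h1 : stretch κ s + c ≤ (1 / ε + c) * Real.exp ((κ + ε) * s) := by
      have h2 : s ≤ 1 / ε * Real.exp (ε * s) := by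
        rw [one_div, ← div_eq_inv_mul, le_div_iff₀ hε0]
        linarith [Real.add_one_le_exp (ε * s)]
      have h3 : stretch κ s ≤ 1 / ε * Real.exp ((κ + ε) * s) := by
        refine (stretch_le hκ hs.le).trans ?_
        rw [add_mul, add_comm (κ * s), Real.exp_add, ← mul_assoc]
        gcongr
      have h4 : 1 ≤ Real.exp ((κ + ε) * s) := Real.one_le_exp (by positivity)
      nlinarith
    calc (stretch κ s + c) ^ r * Real.exp (-s)
        ≤ ((1 / ε + c) * Real.exp ((κ + ε) * s)) ^ r * Real.exp (-s) := by gcongr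
      _ = (1 / ε + c) ^ r * Real.exp (-((1 - κ * r) / 2) * s) := by
        rw [Real.mul_rpow (by positivity) (Real.exp_pos _).le, ← Real.exp_mul, mul_assoc,
          ← Real.exp_add]
        congr 2
        linear_combination s * hεr

/-- Functions dominated by `stretch κ + c` have an integrable `r`-th power. -/
theorem integrableOn_rpow_mul_exp_neg (hκ : 0 ≤ κ) (hr : 0 < r) (hκr : κ * r < 1) {c : ℝ}
    (hc : 0 ≤ c) {h : ℝ → ℝ} (hm : Continuous h)
    (h0 : ∀ s, 0 < s → 0 ≤ h s) (hle : ∀ s, 0 < s → h s ≤ stretch κ s + c) :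
    IntegrableOn (fun s => h s ^ r * Real.exp (-s)) (Set.Ioi 0) := by
  refine (integrableOn_stretch_add_rpow hκ hr hκr hc).mono' ?_ ?_
  · exact ((hm.rpow_const fun _ => Or.inr hr.le).mul (by fun_prop)).aestronglyMeasurable
  · refine (ae_restrict_mem measurableSet_Ioi).mono fun s hs => ?_
    have hs : 0 < s := hs
    have := h0 s hs
    rw [Real.norm_of_nonneg (mul_nonneg (Real.rpow_nonneg this _) (Real.exp_pos _).le)]
    have := hle s hs
    gcongr

theorem setIntegral_Ioi_comp_add (f : ℝ → ℝ) (p : ℝ) :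
    ∫ s in Set.Ioi 0, f (s + p) = ∫ s in Set.Ioi p, f s := by
  have := (measurePreserving_add_right volume p).setIntegral_preimage_emb
    (measurableEmbedding_addRight p) f (Set.Ioi p)
  simpa using this

/-- Self-similarity of the tail integrals. -/
theorem setIntegral_Ioi_rpow_mul_exp_neg {p : ℝ} {g k : ℝ → ℝ}
    (hgk : ∀ s, 0 < s → g (s + p) = Real.exp (κ * p) * k s) (hk : ∀ s, 0 < s → 0 ≤ k s) :
    ∫ s in Set.Ioi p, g s ^ r * Real.exp (-s) =
      Real.exp (-((1 - κ * r) * p)) * ∫ s in Set.Ioi 0, k s ^ r * Real.exp (-s) := by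
  rw [← setIntegral_Ioi_comp_add, ← integral_const_mul]
  refine setIntegral_congr_fun measurableSet_Ioi fun s hs => ?_
  have hs : 0 < s := hs
  rw [hgk s hs, Real.mul_rpow (Real.exp_pos _).le (hk s hs), ← Real.exp_mul, neg_add, Real.exp_add,
    show -((1 - κ * r) * p) = κ * p * r + -p by ring, Real.exp_add]
  ring

theorem exp_mul_rpow_mul_exp_neg {b s : ℝ} (hb : 0 ≤ b) :
    (Real.exp (κ * s) * b) ^ r * Real.exp (-s) = b ^ r * Real.exp (-(1 - κ * r) * s) := by
  rw [Real.mul_rpow (Real.exp_pos _).le hb, ← Real.exp_mul, mul_comm _ (b ^ r), mul_assoc,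
    ← Real.exp_add]
  congr 2
  ring

theorem integrableOn_exp_mul_rpow (hκr : κ * r < 1) {b : ℝ} (hb : 0 ≤ b) (p : ℝ) :
    IntegrableOn (fun s => (Real.exp (κ * s) * b) ^ r * Real.exp (-s)) (Set.Ioi p) := by
  simp only [exp_mul_rpow_mul_exp_neg hb]
  exact (exp_neg_integrableOn_Ioi p (by linarith)).const_mul _

/-- Read from right to left, it replaces an affine copy beyond `p` of a grid of distortion `b ^ r /
(1 - κ r)` by an equivalent pointwise distance that does not depend on `p`. -/
theorem setIntegral_exp_mul_rpow (hκr : κ * r < 1) {b : ℝ} (hb : 0 ≤ b) (p : ℝ) :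
    ∫ s in Set.Ioi p, (Real.exp (κ * s) * b) ^ r * Real.exp (-s) =
      Real.exp (-((1 - κ * r) * p)) * (b ^ r / (1 - κ * r)) := by
  simp only [exp_mul_rpow_mul_exp_neg hb]
  rw [integral_const_mul, integral_exp_mul_Ioi (by linarith), neg_mul]
  have : 1 - κ * r ≠ 0 := by linarith
  field_simp

/-- The integral `∫₀ᶻ exp ((1 - κ r) v) |stretch κ v| ^ r dv`. -/
noncomputable def stretchMoment (κ r z : ℝ) : ℝ :=
  ∫ v in (0 : ℝ)..z, Real.exp ((1 - κ * r) * v) * |stretch κ v| ^ r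

/-- The function whose equality at `p` and `-q` expresses that the interval between the
parameters `-q` and `p` has its center at `0`. -/
noncomputable def stretchBalance (κ r z : ℝ) : ℝ :=
  Real.exp ((1 - κ * r) * z) * |stretch κ z| ^ r - (1 - κ * r) * stretchMoment κ r z

theorem continuous_moment_integrand (hr : 0 < r) :
    Continuous fun v => Real.exp ((1 - κ * r) * v) * |stretch κ v| ^ r :=
  Continuous.mul (by fun_prop)
    ((continuous_stretch κ).abs.rpow_const fun _ => Or.inr hr.le)

theorem hasDerivAt_stretchMoment (hr : 0 < r) (z : ℝ) :
    HasDerivAt (stretchMoment κ r) (Real.exp ((1 - κ * r) * z) * |stretch κ z| ^ r) z :=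
  intervalIntegral.integral_hasDerivAt_right
    ((continuous_moment_integrand hr).intervalIntegrable _ _)
    ((continuous_moment_integrand hr).stronglyMeasurableAtFilter _ _)
    (continuous_moment_integrand hr).continuousAt

@[simp] theorem stretchMoment_zero : stretchMoment κ r 0 = 0 := by simp [stretchMoment]

theorem stretchBalance_zero (hr : 0 < r) : stretchBalance κ r 0 = 0 := by
  simp [stretchBalance, Real.zero_rpow hr.ne']

theorem continuous_stretchBalance (hr : 0 < r) : Continuous (stretchBalance κ r) :=
  (continuous_moment_integrand hr).sub (continuous_const.mul
    (continuous_iff_continuousAt.2 fun z => (hasDerivAt_stretchMoment hr z).continuousAt))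

/-- The derivative has the sign of `|stretch κ z| ^ r - c`, and every comparison below is read off
from this sign. -/
theorem hasDerivAt_moment_sub (hr : 0 < r) (c z : ℝ) :
    HasDerivAt (fun z => (1 - κ * r) * stretchMoment κ r z - Real.exp ((1 - κ * r) * z) * c)
      ((1 - κ * r) * Real.exp ((1 - κ * r) * z) * (|stretch κ z| ^ r - c)) z := by
  have h1 := (hasDerivAt_stretchMoment (κ := κ) hr z).const_mul (1 - κ * r)
  have h2 := (((hasDerivAt_id z).const_mul (1 - κ * r)).exp).mul_const c
  refine (h1.sub h2).congr_deriv ?_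
  simp only [id, mul_one]
  ring

theorem moment_sub_lt (hr : 0 < r) (hκr : κ * r < 1) {a c : ℝ} (hac : a < c) {y : ℝ}
    (h : ∀ s ∈ Set.Ioo a c, y < |stretch κ s| ^ r) :
    (1 - κ * r) * stretchMoment κ r a - Real.exp ((1 - κ * r) * a) * y <
      (1 - κ * r) * stretchMoment κ r c - Real.exp ((1 - κ * r) * c) * y := by
  refine strictMonoOn_of_deriv_pos (convex_Icc a c)
    (fun z _ => (hasDerivAt_moment_sub hr y z).continuousAt.continuousWithinAt) ?_
    (Set.left_mem_Icc.2 hac.le) (Set.right_mem_Icc.2 hac.le) hac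
  intro z hz
  rw [interior_Icc] at hz
  rw [(hasDerivAt_moment_sub hr y z).deriv]
  exact mul_pos (mul_pos (by linarith) (Real.exp_pos _)) (by linarith [h z hz])

theorem lt_moment_sub (hr : 0 < r) (hκr : κ * r < 1) {a c : ℝ} (hac : a < c) {y : ℝ}
    (h : ∀ s ∈ Set.Ioo a c, |stretch κ s| ^ r < y) :
    (1 - κ * r) * stretchMoment κ r c - Real.exp ((1 - κ * r) * c) * y <
      (1 - κ * r) * stretchMoment κ r a - Real.exp ((1 - κ * r) * a) * y := by
  refine strictAntiOn_of_deriv_neg (convex_Icc a c)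
    (fun z _ => (hasDerivAt_moment_sub hr y z).continuousAt.continuousWithinAt) ?_
    (Set.left_mem_Icc.2 hac.le) (Set.right_mem_Icc.2 hac.le) hac
  intro z hz
  rw [interior_Icc] at hz
  rw [(hasDerivAt_moment_sub hr y z).deriv]
  exact mul_neg_of_pos_of_neg (mul_pos (by linarith) (Real.exp_pos _)) (by linarith [h z hz])

/-- On the half-line the derivative changes sign only at `p`, from negative to positive. This is
where uniqueness of the optimal grid originates. -/
theorem moment_sub_lt_of_ne (hr : 0 < r) (hκr : κ * r < 1) {p z : ℝ} (hp : 0 ≤ p) (hz : 0 ≤ z)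
    (hne : z ≠ p) :
    (1 - κ * r) * stretchMoment κ r p - Real.exp ((1 - κ * r) * p) * stretch κ p ^ r <
      (1 - κ * r) * stretchMoment κ r z - Real.exp ((1 - κ * r) * z) * stretch κ p ^ r := by
  rcases hne.lt_or_gt with h | h
  · refine lt_moment_sub hr hκr h fun s hs => ?_
    have hs0 := stretch_nonneg (κ := κ) (hz.trans hs.1.le)
    rw [abs_of_nonneg hs0]
    exact Real.rpow_lt_rpow hs0 (strictMono_stretch κ hs.2) hr
  · refine moment_sub_lt hr hκr h fun s hs => ?_
    rw [abs_of_nonneg (stretch_nonneg (κ := κ) (hp.trans hs.1.le))]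
    exact Real.rpow_lt_rpow (stretch_nonneg hp) (strictMono_stretch κ hs.1) hr

/-- The comparison of `p` with `0` in `moment_sub_lt_of_ne`. Together with `stretchBalance_neg_lt`
it forces the grid parameters to decrease strictly. -/
theorem rpow_lt_stretchBalance (hr : 0 < r) (hκr : κ * r < 1) {p : ℝ} (hp : 0 < p) :
    stretch κ p ^ r < stretchBalance κ r p := by
  have := moment_sub_lt_of_ne (κ := κ) hr hκr hp.le le_rfl hp.ne
  rw [stretchBalance, abs_of_pos (stretch_pos hp)]
  simp at this
  linarith

theorem stretchBalance_neg_lt (hr : 0 < r) (hκr : κ * r < 1) {q : ℝ} (hq : 0 < q) :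
    stretchBalance κ r (-q) < (-stretch κ (-q)) ^ r := by
  have hneg : stretch κ (-q) < 0 := by simpa using strictMono_stretch κ (neg_lt_zero.2 hq)
  have := lt_moment_sub (κ := κ) hr hκr (neg_lt_zero.2 hq) (y := (-stretch κ (-q)) ^ r) ?_
  · rw [stretchBalance, abs_of_neg hneg]
    simp only [stretchMoment_zero, mul_zero, Real.exp_zero] at this
    linarith
  · intro s hs
    have hs0 : stretch κ s < 0 := by simpa using strictMono_stretch κ hs.2
    rw [abs_of_neg hs0]
    exact Real.rpow_lt_rpow (by linarith) (neg_lt_neg (strictMono_stretch κ hs.1)) hr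

theorem stretchBalance_neg_pos (hr : 0 < r) (hκr : κ * r < 1) {q : ℝ} (hq : 0 < q) :
    0 < stretchBalance κ r (-q) := by
  have hneg : stretch κ (-q) < 0 := by simpa using strictMono_stretch κ (neg_lt_zero.2 hq)
  have := moment_sub_lt (κ := κ) hr hκr (neg_lt_zero.2 hq) (y := 0) fun s hs => by
    have hs0 : stretch κ s < 0 := by simpa using strictMono_stretch κ hs.2
    exact Real.rpow_pos_of_pos (abs_pos.2 hs0.ne) _
  rw [stretchBalance]
  have h2 := mul_pos (Real.exp_pos ((1 - κ * r) * -q)) (Real.rpow_pos_of_pos (abs_pos.2 hneg.ne) r)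
  simp only [stretchMoment_zero] at this
  linarith

theorem exists_stretchBalance_eq (hκ : 0 ≤ κ) (hr : 0 < r) (hκr : κ * r < 1) {y : ℝ}
    (hy : 0 < y) : ∃ p, 0 < p ∧ stretchBalance κ r p = y := by
  have ht : Tendsto (fun p => stretch κ p ^ r) atTop atTop :=
    (tendsto_rpow_atTop hr).comp (tendsto_stretch_atTop hκ)
  obtain ⟨s, hs, h⟩ := ((ht.eventually_ge_atTop y).and (eventually_gt_atTop 0)).exists
  have h2 := rpow_lt_stretchBalance hr hκr (κ := κ) h
  obtain ⟨t, ht, h'⟩ := intermediate_value_Icc h.le (continuous_stretchBalance hr).continuousOn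
    (show y ∈ Set.Icc (stretchBalance κ r 0) (stretchBalance κ r s) from
      ⟨by rw [stretchBalance_zero hr]; exact hy.le, hs.trans h2.le⟩)
  refine ⟨t, lt_of_le_of_ne ht.1 ?_, h'⟩
  rintro rfl
  rw [stretchBalance_zero hr] at h'
  exact hy.ne h'

/-- The contribution of the part of the first cell to the left of its point. -/
theorem integral_left_of_center {z : ℝ} (hz : 0 ≤ z) :
    ∫ s in (0 : ℝ)..z, (stretch κ z - stretch κ s) ^ r * Real.exp (-s) =
      Real.exp (-((1 - κ * r) * z)) * stretchMoment κ r z := by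
  have h := intervalIntegral.integral_comp_sub_left (a := 0) (b := z)
    (fun s => (stretch κ z - stretch κ s) ^ r * Real.exp (-s)) z
  rw [sub_self, sub_zero] at h
  rw [← h, stretchMoment, ← intervalIntegral.integral_const_mul]
  refine intervalIntegral.integral_congr fun s hs => ?_
  rw [Set.uIcc_of_le hz] at hs
  have hs0 := stretch_nonneg (κ := κ) hs.1
  have h1 : stretch κ z - stretch κ (z - s) = Real.exp (κ * (z - s)) * stretch κ s := by
    have := stretch_add κ (z - s) s
    rw [sub_add_cancel] at this
    linarith
  rw [h1, exp_mul_rpow_mul_exp_neg hs0, abs_of_nonneg hs0, ← mul_assoc, ← Real.exp_add,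
    mul_comm]
  congr 2
  ring

/-- The contribution of everything to the right of the first point, with the tail cells
contributing as much as the distance `exp (κ s) * b`. -/
noncomputable def tailCost (κ r b : ℝ) : ℝ :=
  ∫ s in Set.Ioi 0, (min (stretch κ s) (Real.exp (κ * s) * b)) ^ r * Real.exp (-s)

theorem stretch_eq_abs {s : ℝ} (hs : 0 ≤ s) :
    stretch κ s = Real.exp (κ * s) * |stretch κ (-s)| := by
  rw [stretch_neg, abs_neg, abs_of_nonneg (mul_nonneg (Real.exp_pos _).le (stretch_nonneg hs)),
    ← mul_assoc, ← Real.exp_add]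
  simp

theorem integral_stretch_rpow {q : ℝ} (hq : 0 ≤ q) :
    ∫ s in (0 : ℝ)..q, stretch κ s ^ r * Real.exp (-s) = -stretchMoment κ r (-q) := by
  have h := intervalIntegral.integral_comp_neg (a := 0) (b := q)
    (fun v => Real.exp ((1 - κ * r) * v) * |stretch κ v| ^ r)
  rw [neg_zero] at h
  rw [stretchMoment, intervalIntegral.integral_symm (-q) 0, neg_neg, ← h]
  refine intervalIntegral.integral_congr fun s hs => ?_
  rw [Set.uIcc_of_le hq] at hs
  rw [stretch_eq_abs hs.1, exp_mul_rpow_mul_exp_neg (abs_nonneg _), mul_comm]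
  congr 2
  ring

theorem integrableOn_tailCost (hκ : 0 ≤ κ) (hr : 0 < r) (hκr : κ * r < 1) {b : ℝ} (hb : 0 ≤ b) :
    IntegrableOn (fun s => (min (stretch κ s) (Real.exp (κ * s) * b)) ^ r * Real.exp (-s))
      (Set.Ioi 0) :=
  integrableOn_rpow_mul_exp_neg hκ hr hκr le_rfl (by fun_prop)
    (fun s hs => le_min (stretch_nonneg hs.le) (by positivity))
    (fun s hs => by simp)

/-- The two terms of the minimum cross at `s = q`. Below `q` the reflection `s ↦ -s` produces the
moment at `-q`; beyond `q` the integral is elementary. -/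
theorem tailCost_eq (hκ : 0 ≤ κ) (hr : 0 < r) (hκr : κ * r < 1) {q : ℝ} (hq : 0 ≤ q) :
    (1 - κ * r) * tailCost κ r (-stretch κ (-q)) = stretchBalance κ r (-q) := by
  have hb : 0 ≤ -stretch κ (-q) := by
    have := (strictMono_stretch κ).monotone (neg_nonpos.2 hq)
    rw [stretch_zero] at this
    linarith
  have hmono : ∀ s, Real.exp (κ * s) * (-stretch κ (-s)) = stretch κ s := fun s => by
    rw [stretch_eq κ s]; ring
  have hint := integrableOn_tailCost hκ hr hκr hb
  rw [tailCost, ← intervalIntegral.integral_interval_add_Ioi hint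
    (hint.mono_set (Set.Ioi_subset_Ioi hq))]
  have h1 : ∫ s in (0 : ℝ)..q, (min (stretch κ s) (Real.exp (κ * s) * -stretch κ (-q))) ^ r *
      Real.exp (-s) = ∫ s in (0 : ℝ)..q, stretch κ s ^ r * Real.exp (-s) := by
    refine intervalIntegral.integral_congr fun s hs => ?_
    rw [Set.uIcc_of_le hq] at hs
    rw [min_eq_left]
    rw [← hmono s]
    have := (strictMono_stretch κ).monotone (neg_le_neg hs.2)
    gcongr
  have h2 : ∫ s in Set.Ioi q, (min (stretch κ s) (Real.exp (κ * s) * -stretch κ (-q))) ^ r *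
      Real.exp (-s) = ∫ s in Set.Ioi q, (Real.exp (κ * s) * -stretch κ (-q)) ^ r *
      Real.exp (-s) := by
    refine setIntegral_congr_fun measurableSet_Ioi fun s hs => ?_
    have hs : q < s := hs
    rw [min_eq_right]
    rw [← hmono s]
    have := (strictMono_stretch κ).monotone (neg_le_neg hs.le)
    gcongr
  have hθ : 1 - κ * r ≠ 0 := by linarith
  rw [h1, h2, integral_stretch_rpow hq, setIntegral_exp_mul_rpow hκr hb, stretchBalance,
    abs_of_nonpos (by linarith : stretch κ (-q) ≤ 0), mul_neg]
  field_simp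
  ring

theorem setIntegral_min_tail {b : ℝ} (hb : 0 ≤ b) (z : ℝ) :
    ∫ s in Set.Ioi z, (min (stretch κ s - stretch κ z) (Real.exp (κ * s) * b)) ^ r *
      Real.exp (-s) = Real.exp (-((1 - κ * r) * z)) * tailCost κ r b := by
  refine setIntegral_Ioi_rpow_mul_exp_neg (fun s hs => ?_) fun s hs =>
    le_min (stretch_nonneg hs.le) (by positivity)
  rw [mul_min_of_nonneg _ _ (Real.exp_pos _).le, add_comm s z, stretch_add, mul_add, Real.exp_add,
    add_sub_cancel_left, mul_assoc]

/-- The `r`-th moment of the generalized Pareto law. -/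
noncomputable def fullCost (κ r : ℝ) : ℝ :=
  ∫ s in Set.Ioi 0, stretch κ s ^ r * Real.exp (-s)

theorem integrableOn_fullCost (hκ : 0 ≤ κ) (hr : 0 < r) (hκr : κ * r < 1) :
    IntegrableOn (fun s => stretch κ s ^ r * Real.exp (-s)) (Set.Ioi 0) :=
  integrableOn_rpow_mul_exp_neg hκ hr hκr le_rfl (by fun_prop)
    (fun s hs => stretch_nonneg hs.le) (fun s hs => by simp)

theorem setIntegral_full_tail (z : ℝ) :
    ∫ s in Set.Ioi z, (stretch κ s - stretch κ z) ^ r * Real.exp (-s) =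
      Real.exp (-((1 - κ * r) * z)) * fullCost κ r := by
  refine setIntegral_Ioi_rpow_mul_exp_neg (fun s hs => ?_) fun s hs => stretch_nonneg hs.le
  rw [add_comm s z, stretch_add, add_sub_cancel_left]

theorem fullCost_pos (hκ : 0 ≤ κ) (hr : 0 < r) (hκr : κ * r < 1) : 0 < fullCost κ r := by
  refine (setIntegral_pos_iff_support_of_nonneg_ae ?_ (integrableOn_fullCost hκ hr hκr)).2 ?_
  · refine (ae_restrict_mem measurableSet_Ioi).mono fun s hs => ?_
    exact mul_nonneg (Real.rpow_nonneg (stretch_nonneg (le_of_lt hs)) _) (Real.exp_pos _).le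
  · refine lt_of_lt_of_le (by simp) (measure_mono (s := Set.Ioi (0 : ℝ)) fun s hs => ⟨?_, hs⟩)
    exact (mul_pos (Real.rpow_pos_of_pos (stretch_pos hs) _) (Real.exp_pos _)).ne'

/-- Follows from `stretch κ s ≤ exp (κ s) / κ`. It keeps the first grid parameter in the range where
`exists_neg_stretch_neg_eq` applies. -/
theorem fullCost_le (hκ : 0 < κ) (hr : 0 < r) (hκr : κ * r < 1) :
    (1 - κ * r) * fullCost κ r ≤ (1 / κ) ^ r := by
  have h := setIntegral_exp_mul_rpow (r := r) hκr (one_div_pos.2 hκ).le 0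
  have hle : fullCost κ r ≤ (1 / κ) ^ r / (1 - κ * r) := by
    rw [mul_zero, neg_zero, Real.exp_zero, one_mul] at h
    rw [← h]
    refine setIntegral_mono_on (integrableOn_fullCost hκ.le hr hκr)
      (integrableOn_exp_mul_rpow hκr (one_div_pos.2 hκ).le 0) measurableSet_Ioi fun s hs => ?_
    have h1 := one_add_mul_stretch κ s
    have h2 : stretch κ s ≤ Real.exp (κ * s) * (1 / κ) := by
      rw [mul_one_div, le_div_iff₀ hκ]
      linarith
    have := stretch_nonneg (κ := κ) (le_of_lt hs)
    gcongr
  rw [le_div_iff₀ (by linarith)] at hle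
  linarith

/-- The minimization over the first point of the grid. -/
theorem rpow_lt_of_balance (hr : 0 < r) (hκr : κ * r < 1) {p z k : ℝ} (hp : 0 ≤ p) (hz : 0 ≤ z)
    (hk : stretchBalance κ r p = (1 - κ * r) * k) (hne : z ≠ p) :
    stretch κ p ^ r / (1 - κ * r) <
      Real.exp (-((1 - κ * r) * z)) * (stretchMoment κ r z + k) := by
  have h := moment_sub_lt_of_ne (κ := κ) hr hκr hp hz hne
  have hθ : 0 < 1 - κ * r := by linarith
  rw [stretchBalance, abs_of_nonneg (stretch_nonneg hp)] at hk
  rw [div_lt_iff₀ hθ, Real.exp_neg, mul_assoc, ← div_eq_inv_mul, lt_div_iff₀ (Real.exp_pos _)]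
  linarith

/-- The value at the critical point is again an `r`-th power over `1 - κ r`, which lets the
induction on the level close. -/
theorem rpow_eq_of_balance (hκr : κ * r < 1) {p k : ℝ} (hp : 0 ≤ p)
    (hk : stretchBalance κ r p = (1 - κ * r) * k) :
    Real.exp (-((1 - κ * r) * p)) * (stretchMoment κ r p + k) = stretch κ p ^ r / (1 - κ * r) := by
  have hθ : 0 < 1 - κ * r := by linarith
  rw [stretchBalance, abs_of_nonneg (stretch_nonneg hp)] at hk
  rw [eq_div_iff hθ.ne', Real.exp_neg, mul_assoc, ← div_eq_inv_mul, div_eq_iff (Real.exp_pos _).ne']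
  linarith

end Integrals

/-! ### Distortion of a grid, and its comparison with the one-variable cost. -/

theorem infDist_affine {c : ℝ} (hc : 0 < c) (d y : ℝ) {β : Finset ℝ} (hβ : β.Nonempty) :
    Metric.infDist (d + c * y) (β.image fun t => d + c * t : Finset ℝ) =
      c * Metric.infDist y β := by
  have hβ' : (β.image fun t => d + c * t).Nonempty := hβ.image _
  have hd : ∀ a, dist (d + c * y) (d + c * a) = c * dist y a := fun a => by
    rw [Real.dist_eq, Real.dist_eq, ← abs_of_pos hc, ← abs_mul, abs_of_pos hc]
    ring_nf
  apply le_antisymm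
  · rw [← div_le_iff₀' hc, Metric.le_infDist (by exact_mod_cast hβ)]
    intro a ha
    rw [div_le_iff₀' hc, ← hd]
    exact Metric.infDist_le_dist_of_mem (by
      exact_mod_cast Finset.mem_image_of_mem _ (Finset.mem_coe.1 ha))
  · rw [Metric.le_infDist (by exact_mod_cast hβ')]
    intro a ha
    simp only [Finset.coe_image, Set.mem_image, Finset.mem_coe] at ha
    obtain ⟨t, ht, rfl⟩ := ha
    rw [hd]
    gcongr
    exact Metric.infDist_le_dist_of_mem (by exact_mod_cast ht)

/-- The `r`-th power of the quantization error of the grid `α` for `stretch κ S`,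
with `S` exponentially distributed. -/
noncomputable def distortion (κ r : ℝ) (α : Finset ℝ) : ℝ :=
  ∫ s in Set.Ioi 0, Metric.infDist (stretch κ s) (α : Set ℝ) ^ r * Real.exp (-s)

section Distortion

variable {κ r : ℝ}

@[fun_prop]
theorem continuous_infDist_stretch (κ : ℝ) (α : Set ℝ) :
    Continuous fun s => Metric.infDist (stretch κ s) α :=
  (Metric.continuous_infDist_pt _).comp (continuous_stretch κ)

theorem integrableOn_distortion (hκ : 0 ≤ κ) (hr : 0 < r) (hκr : κ * r < 1) {α : Finset ℝ}
    (hα : α.Nonempty) :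
    IntegrableOn (fun s => Metric.infDist (stretch κ s) (α : Set ℝ) ^ r * Real.exp (-s))
      (Set.Ioi 0) := by
  obtain ⟨a, ha⟩ := hα
  refine integrableOn_rpow_mul_exp_neg hκ hr hκr (abs_nonneg a) (by fun_prop)
    (fun s _ => Metric.infDist_nonneg) fun s hs => ?_
  refine (Metric.infDist_le_dist_of_mem (by exact_mod_cast ha)).trans ?_
  rw [Real.dist_eq]
  refine (abs_sub _ _).trans ?_
  rw [abs_of_pos (stretch_pos hs)]

theorem setIntegral_infDist_tail {P : ℝ} {β : Finset ℝ} (hβ : β.Nonempty) :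
    ∫ s in Set.Ioi P, Metric.infDist (stretch κ s)
      (β.image fun t => stretch κ P + Real.exp (κ * P) * t : Finset ℝ) ^ r * Real.exp (-s) =
      Real.exp (-((1 - κ * r) * P)) * distortion κ r β := by
  refine setIntegral_Ioi_rpow_mul_exp_neg (fun s hs => ?_) fun s hs => Metric.infDist_nonneg
  rw [add_comm s P, stretch_add, infDist_affine (Real.exp_pos _) _ _ hβ]

theorem intervalIntegrable_rpow_mul_exp_neg (hr : 0 < r) {h : ℝ → ℝ} (hm : Continuous h)
    (a b : ℝ) : IntervalIntegrable (fun s => h s ^ r * Real.exp (-s)) volume a b :=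
  ((hm.rpow_const fun _ => Or.inr hr.le).mul (by fun_prop)).intervalIntegrable _ _

theorem integral_rpow_mul_exp_neg_mono (hr : 0 < r) {g h : ℝ → ℝ} (hg : Continuous g)
    (hh : Continuous h) {a b : ℝ} (hab : a ≤ b) (h0 : ∀ s ∈ Set.Icc a b, 0 ≤ g s)
    (hgh : ∀ s ∈ Set.Icc a b, g s ≤ h s) :
    ∫ s in a..b, g s ^ r * Real.exp (-s) ≤ ∫ s in a..b, h s ^ r * Real.exp (-s) := by
  refine intervalIntegral.integral_mono_on hab (intervalIntegrable_rpow_mul_exp_neg hr hg _ _)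
    (intervalIntegrable_rpow_mul_exp_neg hr hh _ _) fun s hs => ?_
  have := h0 s hs
  have := hgh s hs
  gcongr

theorem integrableOn_Ioi_min (hr : 0 < r) (hκr : κ * r < 1) {b : ℝ} (hb : 0 ≤ b) (z : ℝ) :
    IntegrableOn (fun s => (min (stretch κ s - stretch κ z) (Real.exp (κ * s) * b)) ^ r *
      Real.exp (-s)) (Set.Ioi z) := by
  refine (integrableOn_exp_mul_rpow (r := r) hκr hb z).mono' ?_ ?_
  · exact (Continuous.mul (Continuous.rpow_const (by fun_prop) fun _ => Or.inr hr.le)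
      (by fun_prop)).aestronglyMeasurable
  · refine (ae_restrict_mem measurableSet_Ioi).mono fun s hs => ?_
    have h0 : 0 ≤ min (stretch κ s - stretch κ z) (Real.exp (κ * s) * b) :=
      le_min (sub_nonneg.2 ((strictMono_stretch κ).monotone (le_of_lt hs))) (by positivity)
    rw [Real.norm_of_nonneg (mul_nonneg (Real.rpow_nonneg h0 _) (Real.exp_pos _).le)]
    have : min (stretch κ s - stretch κ z) (Real.exp (κ * s) * b) ≤ Real.exp (κ * s) * b :=
      min_le_right _ _
    gcongr

/-- Wherever the cut `P` is made, each side dominates the pointwise minimum of the two distances, so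
no optimization over `P` is needed. -/
theorem le_first_cell_add_tail (hr : 0 < r) (hκr : κ * r < 1) {z P b : ℝ}
    (hz : 0 ≤ z) (hzP : z ≤ P) (hb : 0 ≤ b) {d : ℝ → ℝ} (hd : Continuous d)
    (hle : ∀ s ∈ Set.Icc 0 P, |stretch κ s - stretch κ z| ≤ d s) :
    Real.exp (-((1 - κ * r) * z)) * (stretchMoment κ r z + tailCost κ r b) ≤
      (∫ s in (0 : ℝ)..P, d s ^ r * Real.exp (-s)) +
        Real.exp (-((1 - κ * r) * P)) * (b ^ r / (1 - κ * r)) := by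
  have hmono := (strictMono_stretch κ).monotone
  rw [mul_add, ← integral_left_of_center hz, ← setIntegral_min_tail hb,
    ← setIntegral_exp_mul_rpow hκr hb]
  have hint := integrableOn_Ioi_min hr hκr hb z
  rw [← intervalIntegral.integral_interval_add_Ioi hint (hint.mono_set (Set.Ioi_subset_Ioi hzP)),
    ← intervalIntegral.integral_add_adjacent_intervals
      (intervalIntegrable_rpow_mul_exp_neg hr hd 0 z)
      (intervalIntegrable_rpow_mul_exp_neg hr hd z P), ← add_assoc]
  refine add_le_add (add_le_add ?_ ?_) ?_
  · refine integral_rpow_mul_exp_neg_mono hr (by fun_prop) hd hz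
      (fun s hs => sub_nonneg.2 (hmono hs.2)) fun s hs => ?_
    refine le_trans ?_ (hle s ⟨hs.1, hs.2.trans hzP⟩)
    rw [abs_sub_comm]
    exact le_abs_self _
  · refine integral_rpow_mul_exp_neg_mono hr (by fun_prop) hd hzP
      (fun s hs => le_min (sub_nonneg.2 (hmono hs.1)) (by positivity)) fun s hs => ?_
    exact (min_le_left _ _).trans ((le_abs_self _).trans (hle s ⟨hz.trans hs.1, hs.2⟩))
  · refine setIntegral_mono_on (hint.mono_set (Set.Ioi_subset_Ioi hzP))
      (integrableOn_exp_mul_rpow hκr hb P) measurableSet_Ioi fun s hs => ?_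
    have h0 : 0 ≤ min (stretch κ s - stretch κ z) (Real.exp (κ * s) * b) :=
      le_min (sub_nonneg.2 (hmono (hzP.trans (le_of_lt hs)))) (by positivity)
    have : min (stretch κ s - stretch κ z) (Real.exp (κ * s) * b) ≤ Real.exp (κ * s) * b :=
      min_le_right _ _
    gcongr

/-- Relative to the scale `exp (κ * s)`, the distance to the point of parameter `z` depends only on
`s - z`; this locates the crossing with `exp (κ * s) * b`. -/
theorem stretch_sub_eq (s z : ℝ) :
    stretch κ s - stretch κ z = Real.exp (κ * s) * -stretch κ (-(s - z)) := by
  have := stretch_add κ s (z - s)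
  rw [add_sub_cancel] at this
  rw [neg_sub]
  linarith

/-- The converse of `le_first_cell_add_tail`: at the cut `z + q`, where the two distances cross, the
pointwise minimum is attained on both sides. -/
theorem first_cell_add_tail_le (hr : 0 < r) (hκr : κ * r < 1) {z q : ℝ}
    (hz : 0 ≤ z) (hq : 0 ≤ q) {d : ℝ → ℝ} (hd : Continuous d) (hd0 : ∀ s, 0 ≤ d s)
    (hle : ∀ s, d s ≤ |stretch κ s - stretch κ z|) :
    (∫ s in (0 : ℝ)..z + q, d s ^ r * Real.exp (-s)) +
        Real.exp (-((1 - κ * r) * (z + q))) * ((-stretch κ (-q)) ^ r / (1 - κ * r)) ≤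
    Real.exp (-((1 - κ * r) * z)) *
      (stretchMoment κ r z + tailCost κ r (-stretch κ (-q))) := by
  have hmono := (strictMono_stretch κ).monotone
  have hzP : z ≤ z + q := by linarith
  have hb : 0 ≤ -stretch κ (-q) := by simpa using hmono (neg_nonpos.2 hq)
  rw [mul_add (Real.exp (-((1 - κ * r) * z))), ← integral_left_of_center hz, ← setIntegral_min_tail hb,
    ← setIntegral_exp_mul_rpow hκr hb]
  have hint := integrableOn_Ioi_min hr hκr hb z
  rw [← intervalIntegral.integral_interval_add_Ioi hint (hint.mono_set (Set.Ioi_subset_Ioi hzP)),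
    ← intervalIntegral.integral_add_adjacent_intervals
      (intervalIntegrable_rpow_mul_exp_neg hr hd 0 z)
      (intervalIntegrable_rpow_mul_exp_neg hr hd z (z + q)), ← add_assoc]
  refine add_le_add (add_le_add ?_ ?_) ?_
  · refine integral_rpow_mul_exp_neg_mono hr hd (by fun_prop) hz
      (fun s _ => hd0 s) fun s hs => ?_
    refine (hle s).trans ?_
    rw [abs_sub_comm, abs_of_nonneg (sub_nonneg.2 (hmono hs.2))]
  · refine integral_rpow_mul_exp_neg_mono hr hd (by fun_prop) hzP
      (fun s _ => hd0 s) fun s hs => le_min ?_ ?_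
    · refine (hle s).trans ?_
      rw [abs_of_nonneg (sub_nonneg.2 (hmono hs.1))]
    · refine (hle s).trans ?_
      rw [abs_of_nonneg (sub_nonneg.2 (hmono hs.1)), stretch_sub_eq]
      have := hmono (show -q ≤ -(s - z) by linarith [hs.2])
      gcongr
  · refine setIntegral_mono_on (integrableOn_exp_mul_rpow hκr hb _)
      (hint.mono_set (Set.Ioi_subset_Ioi hzP)) measurableSet_Ioi fun s hs => ?_
    have hs : z + q < s := hs
    have : Real.exp (κ * s) * -stretch κ (-q) ≤
        min (stretch κ s - stretch κ z) (Real.exp (κ * s) * -stretch κ (-q)) := by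
      refine le_min ?_ le_rfl
      rw [stretch_sub_eq]
      have := hmono (show -(s - z) ≤ -q by linarith)
      gcongr
    gcongr

/-- Points left of the support can be moved to `0` without loss, so arbitrary real grid points are
covered by parameters `z ≥ 0`. -/
theorem abs_stretch_sub_le {x s z : ℝ} (hs : 0 ≤ s) (hz : stretch κ z = max x 0) :
    |stretch κ s - stretch κ z| ≤ |stretch κ s - x| := by
  rw [hz]
  have := stretch_nonneg (κ := κ) hs
  rcases le_total x 0 with h | h
  · rw [max_eq_right h, sub_zero, abs_of_nonneg this]
    exact (by linarith : stretch κ s ≤ stretch κ s - x).trans (le_abs_self _)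
  · rw [max_eq_left h]

theorem integral_abs_stretch_sub (hκ : 0 ≤ κ) (hr : 0 < r) (hκr : κ * r < 1) {z : ℝ}
    (hz : 0 ≤ z) :
    ∫ s in Set.Ioi 0, |stretch κ s - stretch κ z| ^ r * Real.exp (-s) =
      Real.exp (-((1 - κ * r) * z)) * (stretchMoment κ r z + fullCost κ r) := by
  have hmono := (strictMono_stretch κ).monotone
  have hint : IntegrableOn (fun s => |stretch κ s - stretch κ z| ^ r * Real.exp (-s))
      (Set.Ioi 0) := by
    refine integrableOn_rpow_mul_exp_neg hκ hr hκr (c := stretch κ z) (stretch_nonneg hz)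
      (by fun_prop)
      (fun s _ => abs_nonneg _) fun s hs => ?_
    refine (abs_sub _ _).trans ?_
    rw [abs_of_pos (stretch_pos hs), abs_of_nonneg (stretch_nonneg hz)]
  rw [mul_add, ← integral_left_of_center hz, ← setIntegral_full_tail,
    ← intervalIntegral.integral_interval_add_Ioi hint (hint.mono_set (Set.Ioi_subset_Ioi hz))]
  congr 1
  · refine intervalIntegral.integral_congr fun s hs => ?_
    rw [Set.uIcc_of_le hz] at hs
    rw [abs_sub_comm, abs_of_nonneg (sub_nonneg.2 (hmono hs.2))]
  · refine setIntegral_congr_fun measurableSet_Ioi fun s hs => ?_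
    rw [abs_of_nonneg (sub_nonneg.2 (hmono (le_of_lt hs)))]

theorem distortion_singleton (κ r x : ℝ) :
    distortion κ r {x} = ∫ s in Set.Ioi 0, |stretch κ s - x| ^ r * Real.exp (-s) := by
  simp [distortion, Real.dist_eq]

theorem le_distortion_singleton (hκ : 0 ≤ κ) (hr : 0 < r) (hκr : κ * r < 1) {x z : ℝ}
    (hz : 0 ≤ z) (hxz : stretch κ z = max x 0) :
    Real.exp (-((1 - κ * r) * z)) * (stretchMoment κ r z + fullCost κ r) ≤
      distortion κ r {x} := by
  have h := integrableOn_distortion hκ hr hκr (Finset.singleton_nonempty x)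
  have h' := integrableOn_distortion hκ hr hκr (Finset.singleton_nonempty (stretch κ z))
  simp only [Finset.coe_singleton, Metric.infDist_singleton, Real.dist_eq] at h h'
  rw [← integral_abs_stretch_sub hκ hr hκr hz, distortion_singleton]
  refine setIntegral_mono_on h' h measurableSet_Ioi fun s hs => ?_
  have := abs_stretch_sub_le (κ := κ) (le_of_lt hs) hxz
  gcongr

end Distortion

/-! ### The recursive grids and their unique optimality. -/

/-- The sequences of parameters that generate the optimal grids: `stretch κ (p n)` is the first
point of the optimal grid with `n + 1` points, and `p (n + 1) + q n` is the parameter of the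
boundary between the first two cells of the optimal grid with `n + 2` points. -/
structure IsGridParam (κ r : ℝ) (p q : ℕ → ℝ) : Prop where
  p_pos : ∀ n, 0 < p n
  q_pos : ∀ n, 0 < q n
  init : stretchBalance κ r (p 0) = (1 - κ * r) * fullCost κ r
  link : ∀ n, -stretch κ (-q n) = stretch κ (p n)
  step : ∀ n, stretchBalance κ r (p (n + 1)) = stretchBalance κ r (-q n)

/-- The grids generated by the parameters `p`, `q`. -/
noncomputable def quantizerGrid (κ : ℝ) (p q : ℕ → ℝ) : ℕ → Finset ℝ
  | 0 => {stretch κ (p 0)}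
  | n + 1 => insert (stretch κ (p (n + 1))) ((quantizerGrid κ p q n).image fun t =>
      stretch κ (p (n + 1) + q n) + Real.exp (κ * (p (n + 1) + q n)) * t)

section Grid

variable {κ r : ℝ}

theorem exists_isGridParam (hκ : 0 ≤ κ) (hr : 0 < r) (hκr : κ * r < 1) :
    ∃ p q, IsGridParam κ r p q := by
  have hθ : 0 < 1 - κ * r := by linarith
  -- The bound `κ * stretch κ x < 1` is the solvability condition for `q` in the `link` equation; it
  -- is carried as an invariant, preserved because the parameters decrease.
  have hbase : ∃ p₀, (0 < p₀ ∧ κ * stretch κ p₀ < 1) ∧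
      stretchBalance κ r p₀ = (1 - κ * r) * fullCost κ r := by
    obtain ⟨p₀, hp₀, h⟩ := exists_stretchBalance_eq hκ hr hκr
      (mul_pos hθ (fullCost_pos hκ hr hκr))
    refine ⟨p₀, ⟨hp₀, ?_⟩, h⟩
    rcases hκ.eq_or_lt with rfl | hκ
    · simp
    · by_contra! hcon
      have h1 := rpow_lt_stretchBalance (κ := κ) hr hκr hp₀
      have h2 : 1 / κ ≤ stretch κ p₀ := by rwa [div_le_iff₀' hκ]
      have h3 : (1 / κ) ^ r ≤ stretch κ p₀ ^ r := by gcongr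
      linarith [fullCost_le hκ hr hκr]
  have hstep : ∀ x : {x : ℝ // 0 < x ∧ κ * stretch κ x < 1},
      ∃ y : ℝ, ∃ x' : {x : ℝ // 0 < x ∧ κ * stretch κ x < 1}, 0 < y ∧
        -stretch κ (-y) = stretch κ x ∧ stretchBalance κ r x' = stretchBalance κ r (-y) := by
    rintro ⟨x, hx, hx1⟩
    obtain ⟨y, hy, hyx⟩ := exists_neg_stretch_neg_eq hκ (stretch_pos hx).le hx1
    have hy0 : 0 < y := by
      refine lt_of_le_of_ne hy ?_
      rintro rfl
      have := stretch_pos (κ := κ) hx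
      simp at hyx
      linarith
    obtain ⟨x', hx', h⟩ := exists_stretchBalance_eq hκ hr hκr (stretchBalance_neg_pos hr hκr hy0)
    refine ⟨y, ⟨x', hx', lt_of_le_of_lt ?_ hx1⟩, hy0, hyx, h⟩
    have h1 := rpow_lt_stretchBalance (κ := κ) hr hκr hx'
    have h2 := stretchBalance_neg_lt (κ := κ) hr hκr hy0
    rw [hyx, ← h] at h2
    have := (Real.rpow_lt_rpow_iff (stretch_pos hx').le (stretch_pos hx).le hr).1 (h1.trans h2)
    gcongr
  choose y x' hy hyx hxy using hstep
  obtain ⟨p₀, hp₀, h₀⟩ := hbase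
  let P : ℕ → {x : ℝ // 0 < x ∧ κ * stretch κ x < 1} := fun n => Nat.rec ⟨p₀, hp₀⟩ (fun _ => x') n
  refine ⟨fun n => (P n).1, fun n => y (P n), ?_⟩
  exact ⟨fun n => (P n).2.1, fun n => hy _, h₀, fun n => hyx _, fun n => hxy (P n)⟩

namespace IsGridParam

variable {p q : ℕ → ℝ}

/-- The recursion as the first-order condition for the first point, in the form required by
`rpow_lt_of_balance` and `rpow_eq_of_balance`. -/
theorem balance (h : IsGridParam κ r p q) (hκ : 0 ≤ κ) (hr : 0 < r) (hκr : κ * r < 1) (n : ℕ) :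
    stretchBalance κ r (p (n + 1)) = (1 - κ * r) * tailCost κ r (stretch κ (p n)) := by
  rw [h.step, ← tailCost_eq hκ hr hκr (h.q_pos n).le, h.link]

theorem p_succ_lt (h : IsGridParam κ r p q) (hr : 0 < r) (hκr : κ * r < 1) (n : ℕ) :
    p (n + 1) < p n := by
  have h1 := rpow_lt_stretchBalance (κ := κ) hr hκr (h.p_pos (n + 1))
  have h2 := stretchBalance_neg_lt (κ := κ) hr hκr (h.q_pos n)
  rw [h.link, ← h.step] at h2
  exact (strictMono_stretch κ).lt_iff_lt.1
    ((Real.rpow_lt_rpow_iff (stretch_pos (h.p_pos _)).le (stretch_pos (h.p_pos _)).le hr).1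
      (h1.trans h2))

theorem stretch_mem (n : ℕ) : stretch κ (p n) ∈ quantizerGrid κ p q n := by
  cases n <;> simp [quantizerGrid]

theorem nonempty (n : ℕ) : (quantizerGrid κ p q n).Nonempty := ⟨_, stretch_mem n⟩

theorem card_le (n : ℕ) : (quantizerGrid κ p q n).card ≤ n + 1 := by
  induction n with
  | zero => simp [quantizerGrid]
  | succ n ih =>
    rw [quantizerGrid]
    refine (Finset.card_insert_le _ _).trans ?_
    have := Finset.card_image_le (s := quantizerGrid κ p q n) (f := fun t =>
      stretch κ (p (n + 1) + q n) + Real.exp (κ * (p (n + 1) + q n)) * t)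
    omega

theorem stretch_le_of_mem (h : IsGridParam κ r p q) (n : ℕ) :
    ∀ y ∈ quantizerGrid κ p q n, stretch κ (p n) ≤ y := by
  induction n with
  | zero => simp [quantizerGrid]
  | succ n ih =>
    intro y hy
    rw [quantizerGrid, Finset.mem_insert, Finset.mem_image] at hy
    rcases hy with rfl | ⟨t, ht, rfl⟩
    · exact le_rfl
    · have h1 := (stretch_pos (κ := κ) (h.p_pos n)).le.trans (ih t ht)
      have h2 := (strictMono_stretch κ).monotone
        (show p (n + 1) ≤ p (n + 1) + q n by linarith [h.q_pos n])
      have := mul_nonneg (Real.exp_pos (κ * (p (n + 1) + q n))).le h1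
      linarith

/-- Only an upper bound is proved, since the matching lower bound holds for every competing grid by
`optimal`. Using the tail part of the grid alone beyond the cut can only increase distances. -/
theorem distortion_grid_le (h : IsGridParam κ r p q) (hκ : 0 ≤ κ) (hr : 0 < r)
    (hκr : κ * r < 1) (n : ℕ) :
    distortion κ r (quantizerGrid κ p q n) ≤ stretch κ (p n) ^ r / (1 - κ * r) := by
  induction n with
  | zero =>
    rw [quantizerGrid, distortion_singleton, integral_abs_stretch_sub hκ hr hκr (h.p_pos 0).le,
      rpow_eq_of_balance hκr (h.p_pos 0).le h.init]
  | succ n ih =>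
    have hz := (h.p_pos (n + 1)).le
    have hq := (h.q_pos n).le
    have hP : 0 ≤ p (n + 1) + q n := by linarith
    have hmain := first_cell_add_tail_le hr hκr hz hq
      (d := fun s => Metric.infDist (stretch κ s) (quantizerGrid κ p q (n + 1) : Set ℝ))
      (by fun_prop) (fun s => Metric.infDist_nonneg) fun s => by
        rw [← Real.dist_eq]
        exact Metric.infDist_le_dist_of_mem (by exact_mod_cast stretch_mem (n + 1))
    rw [h.link, rpow_eq_of_balance hκr hz (h.balance hκ hr hκr n)] at hmain
    refine le_trans ?_ hmain
    have hint := integrableOn_distortion hκ hr hκr (nonempty (κ := κ) (p := p) (q := q) (n + 1))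
    have hint' := integrableOn_distortion hκ hr hκr
      ((nonempty (κ := κ) (p := p) (q := q) n).image fun t =>
        stretch κ (p (n + 1) + q n) + Real.exp (κ * (p (n + 1) + q n)) * t)
    rw [distortion, ← intervalIntegral.integral_interval_add_Ioi hint
      (hint.mono_set (Set.Ioi_subset_Ioi hP))]
    refine add_le_add le_rfl ?_
    refine le_trans ?_ (mul_le_mul_of_nonneg_left ih (Real.exp_pos _).le)
    rw [← setIntegral_infDist_tail (nonempty n)]
    refine setIntegral_mono_on (hint.mono_set (Set.Ioi_subset_Ioi hP))
      (hint'.mono_set (Set.Ioi_subset_Ioi hP)) measurableSet_Ioi fun s _ => ?_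
    have : Metric.infDist (stretch κ s) (quantizerGrid κ p q (n + 1) : Set ℝ) ≤
        Metric.infDist (stretch κ s) ((quantizerGrid κ p q n).image fun t =>
          stretch κ (p (n + 1) + q n) + Real.exp (κ * (p (n + 1) + q n)) * t : Finset ℝ) :=
      Metric.infDist_le_infDist_of_subset (by
        rw [quantizerGrid]
        exact_mod_cast Finset.subset_insert _ _) (by exact_mod_cast (nonempty n).image _)
    have := Metric.infDist_nonneg (x := stretch κ s) (s := (quantizerGrid κ p q (n + 1) : Set ℝ))
    gcongr

theorem optimal_zero (h : IsGridParam κ r p q) (hκ : 0 ≤ κ) (hr : 0 < r) (hκr : κ * r < 1)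
    (x : ℝ) : stretch κ (p 0) ^ r / (1 - κ * r) ≤ distortion κ r {x} ∧
      (distortion κ r {x} ≤ stretch κ (p 0) ^ r / (1 - κ * r) → x = stretch κ (p 0)) := by
  obtain ⟨z, hz, hxz⟩ := exists_stretch_eq hκ (le_max_right x 0)
  have h1 := le_distortion_singleton hκ hr hκr hz hxz
  rcases eq_or_ne z (p 0) with rfl | hne
  · rw [rpow_eq_of_balance hκr hz h.init] at h1
    refine ⟨h1, fun _ => ?_⟩
    have := stretch_pos (κ := κ) (h.p_pos 0)
    rw [hxz] at this ⊢
    rw [max_eq_left]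
    by_contra! hx
    rw [max_eq_right hx.le] at this
    exact this.false
  · have h2 := rpow_lt_of_balance hr hκr (h.p_pos 0).le hz h.init hne
    exact ⟨by linarith, fun _ => by linarith⟩

/-- The comparison of a grid `insert x β`, where `x` lies to the left of `β`, with the grid
generated by the parameters. -/
theorem optimal_insert (h : IsGridParam κ r p q) (hκ : 0 ≤ κ) (hr : 0 < r) (hκr : κ * r < 1)
    {n : ℕ}
    (ih : ∀ β : Finset ℝ, β.Nonempty → β.card ≤ n + 1 →
      stretch κ (p n) ^ r / (1 - κ * r) ≤ distortion κ r β ∧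
        (distortion κ r β ≤ stretch κ (p n) ^ r / (1 - κ * r) → β = quantizerGrid κ p q n))
    {x y : ℝ} {β : Finset ℝ} (hy : y ∈ β) (hyβ : ∀ t ∈ β, y ≤ t) (hxy : x < y)
    (hcard : β.card ≤ n + 1) :
    stretch κ (p (n + 1)) ^ r / (1 - κ * r) ≤ distortion κ r (insert x β) ∧
      (distortion κ r (insert x β) ≤ stretch κ (p (n + 1)) ^ r / (1 - κ * r) →
        insert x β = quantizerGrid κ p q (n + 1)) := by
  have hθ : 0 < 1 - κ * r := by linarith
  have hsm := strictMono_stretch κ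
  have hβ : β.Nonempty := ⟨y, hy⟩
  obtain ⟨z, hz, hxz⟩ := exists_stretch_eq hκ (le_max_right x 0)
  -- The cut is the midpoint of the two leftmost points, truncated to the support. A nonpositive
  -- midpoint gives `P = 0` and an empty first cell.
  obtain ⟨P, hP, hmP⟩ := exists_stretch_eq hκ (le_max_right ((x + y) / 2) 0)
  have hzP : z ≤ P := by
    rw [← hsm.le_iff_le, hxz, hmP]
    exact max_le_max_right _ (by linarith)
  set α := insert x β with hα
  have hαn : α.Nonempty := Finset.insert_nonempty _ _
  set c := Real.exp (κ * P) with hc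
  have hc0 : 0 < c := Real.exp_pos _
  -- The remaining points are pulled back by the affine map of the tail, so that the induction
  -- hypothesis applies to them.
  set β' := β.image fun t => (t - stretch κ P) / c with hβ'
  have hβ'n : β'.Nonempty := hβ.image _
  have hββ' : (β'.image fun t => stretch κ P + c * t) = β := by
    rw [hβ', Finset.image_image]
    convert Finset.image_id (s := β) using 2
    ext t
    simp only [Function.comp, id]
    field_simp
    ring
  have hleft : ∀ s ∈ Set.Icc 0 P,
      |stretch κ s - stretch κ z| ≤ Metric.infDist (stretch κ s) (α : Set ℝ) := by
    intro s hs
    rcases le_or_gt ((x + y) / 2) 0 with hm | hm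
    · rw [max_eq_right hm] at hmP
      have hP0 : P = 0 := hsm.injective (by rw [hmP, stretch_zero])
      subst hP0
      have hs0 : s = 0 := le_antisymm hs.2 hs.1
      have hz0 : z = 0 := le_antisymm hzP hz
      rw [hs0, hz0, sub_self, abs_zero]
      exact Metric.infDist_nonneg
    · rw [max_eq_left hm.le] at hmP
      have hsP := hsm.monotone hs.2
      rw [hmP] at hsP
      refine (abs_stretch_sub_le hs.1 hxz).trans ?_
      rw [Metric.le_infDist (by exact_mod_cast hαn)]
      intro t ht
      rw [Finset.mem_coe, hα, Finset.mem_insert] at ht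
      rw [Real.dist_eq]
      rcases ht with rfl | ht
      · exact le_rfl
      · have := hyβ t ht
        rw [abs_le]
        have h1 := neg_abs_le (stretch κ s - t)
        constructor <;> linarith
  have hright : ∀ s ∈ Set.Ioi P, Metric.infDist (stretch κ s) (β : Set ℝ) ≤
      Metric.infDist (stretch κ s) (α : Set ℝ) := by
    intro s hs
    have hsP := hsm.monotone (le_of_lt hs)
    rw [hmP] at hsP
    have hm := (le_max_left _ _).trans hsP
    rw [Metric.le_infDist (by exact_mod_cast hαn)]
    intro t ht
    rw [Finset.mem_coe, hα, Finset.mem_insert] at ht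
    rcases ht with rfl | ht
    · refine (Metric.infDist_le_dist_of_mem (show y ∈ (β : Set ℝ) by exact_mod_cast hy)).trans ?_
      rw [Real.dist_eq, Real.dist_eq, abs_le]
      have h1 := le_abs_self (stretch κ s - t)
      constructor <;> linarith
    · exact Metric.infDist_le_dist_of_mem (by exact_mod_cast ht)
  have hint := integrableOn_distortion hκ hr hκr hαn
  have hint' := integrableOn_distortion hκ hr hκr hβ
  have hsplit : (∫ s in (0 : ℝ)..P, Metric.infDist (stretch κ s) (α : Set ℝ) ^ r * Real.exp (-s)) +
      Real.exp (-((1 - κ * r) * P)) * distortion κ r β' ≤ distortion κ r α := by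
    rw [distortion.eq_1 κ r α, ← intervalIntegral.integral_interval_add_Ioi hint
      (hint.mono_set (Set.Ioi_subset_Ioi hP)), ← setIntegral_infDist_tail hβ'n, hββ']
    refine add_le_add le_rfl ?_
    refine setIntegral_mono_on (hint'.mono_set (Set.Ioi_subset_Ioi hP))
      (hint.mono_set (Set.Ioi_subset_Ioi hP)) measurableSet_Ioi fun s hs => ?_
    have := hright s hs
    have := Metric.infDist_nonneg (x := stretch κ s) (s := (β : Set ℝ))
    gcongr
  have hfirst := le_first_cell_add_tail hr hκr hz hzP (stretch_pos (κ := κ) (h.p_pos n)).le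
    (d := fun s => Metric.infDist (stretch κ s) (α : Set ℝ)) (by fun_prop) hleft
  obtain ⟨ih1, ih2⟩ := ih β' hβ'n (Finset.card_image_le.trans hcard)
  have hexp := Real.exp_pos (-((1 - κ * r) * P))
  have hmul := mul_le_mul_of_nonneg_left ih1 hexp.le
  have hbal := h.balance hκ hr hκr n
  rcases eq_or_ne z (p (n + 1)) with rfl | hne
  · rw [rpow_eq_of_balance hκr hz hbal] at hfirst
    refine ⟨by linarith, fun hle => ?_⟩
    -- Optimality of the whole leaves no slack in the chain of lower bounds, so the pulled-back tail
    -- is itself optimal.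
    have hβeq := ih2 (le_of_mul_le_mul_left (by linarith) hexp)
    have hx : x = stretch κ (p (n + 1)) := by
      have := stretch_pos (κ := κ) (h.p_pos (n + 1))
      rw [hxz] at this ⊢
      rw [max_eq_left]
      by_contra! hx
      rw [max_eq_right hx.le] at this
      exact this.false
    have hx0 : 0 < x := hx ▸ stretch_pos (h.p_pos (n + 1))
    rw [max_eq_left (by linarith)] at hmP
    have hyP : y = stretch κ P + c * stretch κ (p n) := by
      apply le_antisymm
      · apply hyβ
        rw [← hββ', hβeq]
        exact Finset.mem_image_of_mem _ (stretch_mem n)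
      · rw [← hββ', hβeq, Finset.mem_image] at hy
        obtain ⟨t, ht, rfl⟩ := hy
        have := h.stretch_le_of_mem n t ht
        gcongr
    -- `stretch κ P` is equidistant from `x` and `y`; divided by the scale `c`, this is the `link`
    -- equation, and `stretch κ` is injective.
    have hPeq : P = p (n + 1) + q n := by
      have h1 := stretch_sub_eq (κ := κ) P (p (n + 1))
      rw [← hx, ← hc] at h1
      have h2 : c * -stretch κ (-(P - p (n + 1))) = c * -stretch κ (-q n) := by
        rw [← h1, h.link]
        linarith
      have h3 := hsm.injective (neg_injective (mul_left_cancel₀ hc0.ne' h2))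
      linarith
    rw [quantizerGrid, hα, ← hββ', hβeq, hx, hc, hPeq]
  · have h2 := rpow_lt_of_balance hr hκr (h.p_pos (n + 1)).le hz hbal hne
    exact ⟨by linarith, fun _ => by linarith⟩

theorem optimal (h : IsGridParam κ r p q) (hκ : 0 ≤ κ) (hr : 0 < r) (hκr : κ * r < 1) (n : ℕ) :
    ∀ α : Finset ℝ, α.Nonempty → α.card ≤ n + 1 →
      stretch κ (p n) ^ r / (1 - κ * r) ≤ distortion κ r α ∧
        (distortion κ r α ≤ stretch κ (p n) ^ r / (1 - κ * r) → α = quantizerGrid κ p q n) := by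
  have hθ : 0 < 1 - κ * r := by linarith
  induction n with
  | zero =>
    intro α hα hcard
    obtain ⟨x, rfl⟩ := Finset.card_eq_one.1 (le_antisymm hcard (Finset.card_pos.2 hα))
    have := h.optimal_zero hκ hr hκr x
    exact ⟨this.1, fun hle => by rw [quantizerGrid, this.2 hle]⟩
  | succ n ih =>
    intro α hα hcard
    rcases Nat.lt_or_ge (n + 1) α.card with hlt | hge
    · have hx := α.min'_mem hα
      set x := α.min' hα with hxdef
      have hβ : (α.erase x).Nonempty := by
        rw [← Finset.card_pos, Finset.card_erase_of_mem hx]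
        omega
      have hy := (α.erase x).min'_mem hβ
      rw [← Finset.insert_erase hx]
      refine h.optimal_insert hκ hr hκr ih hy (fun t ht => Finset.min'_le _ t ht) ?_ ?_
      · exact lt_of_le_of_ne (Finset.min'_le _ _ (Finset.mem_of_mem_erase hy))
          (Finset.ne_of_mem_erase hy).symm
      · rw [Finset.card_erase_of_mem hx]
        omega
    -- A grid with a point to spare is never optimal, because the lower bounds decrease strictly
    -- with the level.
    · have h1 := (ih α hα hge).1
      have h2 : stretch κ (p (n + 1)) ^ r / (1 - κ * r) < stretch κ (p n) ^ r / (1 - κ * r) := by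
        have := strictMono_stretch κ (h.p_succ_lt hr hκr n)
        have h0 := stretch_pos (κ := κ) (h.p_pos (n + 1))
        gcongr
      exact ⟨by linarith, fun _ => by linarith⟩

end IsGridParam

end Grid

/-! ### Transfer to the exponential and Pareto laws, and the largest point of the grid. -/

/-- `P` is the law of `x₀ + c * stretch κ S` with `S` exponentially distributed. -/
def IsStretchLaw (κ x₀ c : ℝ) (P : Measure ℝ) : Prop :=
  ∀ g : ℝ → ℝ≥0∞, Measurable g →
    ∫⁻ x, g x ∂P = ∫⁻ s in Set.Ioi 0, g (x₀ + c * stretch κ s) * ENNReal.ofReal (Real.exp (-s))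

theorem image_stretch_Ioi {κ : ℝ} (hκ : 0 ≤ κ) (x₀ : ℝ) {c : ℝ} (hc : 0 < c) :
    (fun s => x₀ + c * stretch κ s) '' Set.Ioi 0 = Set.Ioi x₀ := by
  ext x
  constructor
  · rintro ⟨s, hs, rfl⟩
    have := mul_pos hc (stretch_pos (κ := κ) hs)
    simp only [Set.mem_Ioi]
    linarith
  · intro hx
    have hx : x₀ < x := hx
    obtain ⟨s, hs, h⟩ := exists_stretch_eq hκ (div_pos (sub_pos.2 hx) hc).le
    refine ⟨s, lt_of_le_of_ne hs ?_, ?_⟩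
    · rintro rfl
      rw [stretch_zero] at h
      exact (div_pos (sub_pos.2 hx) hc).ne h
    · simp only [h]
      field_simp
      ring

theorem isStretchLaw_withDensity {κ : ℝ} (hκ : 0 ≤ κ) {x₀ c : ℝ} (hc : 0 < c) {ρ : ℝ → ℝ≥0∞}
    (hρ : Measurable ρ) (h0 : ∀ x < x₀, ρ x = 0)
    (h : ∀ s, 0 < s → ENNReal.ofReal (c * Real.exp (κ * s)) * ρ (x₀ + c * stretch κ s) =
      ENNReal.ofReal (Real.exp (-s))) :
    IsStretchLaw κ x₀ c (volume.withDensity ρ) := by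
  intro g hg
  rw [lintegral_withDensity_eq_lintegral_mul _ hρ hg]
  have h1 : ∫⁻ x, (ρ * g) x = ∫⁻ x in Set.Ici x₀, (ρ * g) x := by
    rw [← lintegral_indicator measurableSet_Ici]
    congr 1 with x
    by_cases hx : x₀ ≤ x
    · rw [Set.indicator_of_mem (show x ∈ Set.Ici x₀ from hx)]
    · rw [Set.indicator_of_notMem (show x ∉ Set.Ici x₀ from hx), Pi.mul_apply,
        h0 x (not_le.1 hx), zero_mul]
  rw [h1, setLIntegral_congr Ioi_ae_eq_Ici.symm, ← image_stretch_Ioi hκ x₀ hc,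
    lintegral_image_eq_lintegral_abs_deriv_mul measurableSet_Ioi
      (f' := fun s => c * Real.exp (κ * s))
      (fun s _ => (((hasDerivAt_stretch κ s).const_mul c).const_add x₀).hasDerivWithinAt)
      (fun s _ t _ hst => (strictMono_stretch κ).injective
        (mul_left_cancel₀ hc.ne' (add_left_cancel hst)))]
  refine setLIntegral_congr_fun measurableSet_Ioi fun s hs => ?_
  have := h s hs
  simp only [Pi.mul_apply]
  rw [abs_of_pos (by positivity), ← mul_assoc, this, mul_comm]

theorem isStretchLaw_expMeasure {lam : ℝ} (hlam : 0 < lam) :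
    IsStretchLaw 0 0 (1 / lam) (expMeasure lam) := by
  refine isStretchLaw_withDensity le_rfl (by positivity) (ρ := exponentialPDF lam)
    (measurable_exponentialPDFReal lam).ennreal_ofReal
    (fun x hx => exponentialPDF_of_neg hx) fun s hs => ?_
  rw [stretch_zero_left, zero_add, exponentialPDF_of_nonneg (by positivity),
    ← ENNReal.ofReal_mul (by positivity)]
  congr 1
  simp only [zero_mul, Real.exp_zero]
  field_simp

/-- Taking both `κ` and the scale equal to `1 / γ` makes the affine image equal to `exp (s / γ)`: a
Pareto variable is the exponential of an exponential variable. -/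
theorem isStretchLaw_paretoMeasure {γ : ℝ} (hγ : 0 < γ) :
    IsStretchLaw (1 / γ) 1 (1 / γ) (paretoMeasure 1 γ) := by
  refine isStretchLaw_withDensity (by positivity) (by positivity) (ρ := paretoPDF 1 γ)
    (measurable_paretoPDFReal 1 γ).ennreal_ofReal
    (fun x hx => paretoPDF_of_lt hx) fun s hs => ?_
  rw [one_add_mul_stretch, paretoPDF_of_le (Real.one_le_exp (by positivity)),
    ← ENNReal.ofReal_mul (by positivity), Real.one_rpow, ← Real.exp_mul]
  congr 1
  have : 1 / γ * s * -(γ + 1) = -s - 1 / γ * s := by field_simp; ring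
  rw [this, Real.exp_sub]
  field_simp

section Transfer

variable {κ r x₀ c : ℝ} {P : Measure ℝ}

theorem quantizationError_eq (hP : IsStretchLaw κ x₀ c P) (hκ : 0 ≤ κ) (hr : 0 < r)
    (hκr : κ * r < 1) (hc : 0 < c) {α : Finset ℝ} (hα : α.Nonempty) :
    quantizationError r P (α.image fun t => x₀ + c * t) =
      ENNReal.ofReal (c ^ r * distortion κ r α) ^ (1 / r) := by
  rw [quantizationError, eLpNorm_eq_lintegral_rpow_enorm_toReal
    (ENNReal.ofReal_pos.2 hr).ne' ENNReal.ofReal_ne_top, ENNReal.toReal_ofReal hr.le]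
  congr 1
  have hm : Measurable fun x : ℝ =>
      ‖Metric.infDist x (α.image fun t => x₀ + c * t : Finset ℝ)‖ₑ ^ r :=
    (Metric.continuous_infDist_pt _).measurable.enorm.pow_const _
  rw [hP _ hm, distortion, ← integral_const_mul,
    ofReal_integral_eq_lintegral_ofReal ((integrableOn_distortion hκ hr hκr hα).const_mul _)]
  · refine setLIntegral_congr_fun measurableSet_Ioi fun s _ => ?_
    have h0 := Metric.infDist_nonneg (x := stretch κ s) (s := (α : Set ℝ))
    rw [infDist_affine hc _ _ hα, ← mul_assoc, ← Real.mul_rpow hc.le h0,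
      ENNReal.ofReal_mul (by positivity), Real.enorm_eq_ofReal (by positivity),
      ENNReal.ofReal_rpow_of_nonneg (by positivity) hr.le]
  · refine Eventually.of_forall fun s => ?_
    have h0 := Metric.infDist_nonneg (x := stretch κ s) (s := (α : Set ℝ))
    have := Real.exp_pos (-s)
    simp only [Pi.zero_apply]
    positivity

theorem distortion_nonneg (α : Finset ℝ) : 0 ≤ distortion κ r α :=
  integral_nonneg fun _ => mul_nonneg (Real.rpow_nonneg Metric.infDist_nonneg _) (Real.exp_pos _).le

theorem quantizationError_le_iff (hP : IsStretchLaw κ x₀ c P) (hκ : 0 ≤ κ) (hr : 0 < r)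
    (hκr : κ * r < 1) (hc : 0 < c) {α β : Finset ℝ} (hα : α.Nonempty) (hβ : β.Nonempty) :
    quantizationError r P (α.image fun t => x₀ + c * t) ≤
      quantizationError r P (β.image fun t => x₀ + c * t) ↔
      distortion κ r α ≤ distortion κ r β := by
  have hcr := Real.rpow_pos_of_pos hc r
  rw [quantizationError_eq hP hκ hr hκr hc hα, quantizationError_eq hP hκ hr hκr hc hβ,
    ENNReal.rpow_le_rpow_iff (by positivity),
    ENNReal.ofReal_le_ofReal_iff (mul_nonneg hcr.le (distortion_nonneg _)),
    mul_le_mul_iff_right₀ hcr]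

theorem isOptimalQuantizer_iff (hP : IsStretchLaw κ x₀ c P) (hκ : 0 ≤ κ) (hr : 0 < r)
    (hκr : κ * r < 1) (hc : 0 < c) {p q : ℕ → ℝ} (h : IsGridParam κ r p q) (n : ℕ)
    (α : Finset ℝ) :
    IsOptimalQuantizer r P (n + 1) α ↔
      α = (quantizerGrid κ p q n).image fun t => x₀ + c * t := by
  have hinv : ∀ β : Finset ℝ, (β.image fun t => (t - x₀) / c).image (fun t => x₀ + c * t) = β := by
    intro β
    rw [Finset.image_image]
    convert Finset.image_id (s := β) using 2
    ext t
    simp only [Function.comp, id]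
    field_simp
    ring
  constructor
  · rintro ⟨hα, hcard, hmin⟩
    have h1 := hmin _ ((IsGridParam.nonempty (κ := κ) (p := p) (q := q) n).image
      fun t => x₀ + c * t) (Finset.card_image_le.trans (IsGridParam.card_le n))
    rw [← hinv α, quantizationError_le_iff hP hκ hr hκr hc (hα.image _)
      (IsGridParam.nonempty n)] at h1
    have h2 := (h.optimal hκ hr hκr n _ (hα.image _) (Finset.card_image_le.trans hcard)).2
      (h1.trans (h.distortion_grid_le hκ hr hκr n))
    rw [← h2, hinv]
  · rintro rfl
    refine ⟨(IsGridParam.nonempty n).image _, Finset.card_image_le.trans (IsGridParam.card_le n),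
      fun β hβ hcard => ?_⟩
    rw [← hinv β, quantizationError_le_iff hP hκ hr hκr hc (IsGridParam.nonempty n)
      (hβ.image _)]
    exact (h.distortion_grid_le hκ hr hκr n).trans
      (h.optimal hκ hr hκr n _ (hβ.image _) (Finset.card_image_le.trans hcard)).1

/-- The parameter of the largest point of the grids. -/
def radiusParam (p q : ℕ → ℝ) : ℕ → ℝ
  | 0 => p 0
  | n + 1 => radiusParam p q n + (p (n + 1) + q n)

/-- By `stretch_add`, the affine maps that build the grids act on parameters as translations, so the
parameter of the last point is a plain sum. -/
theorem radiusParam_mem (p q : ℕ → ℝ) (n : ℕ) :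
    stretch κ (radiusParam p q n) ∈ quantizerGrid κ p q n := by
  induction n with
  | zero => simp [quantizerGrid, radiusParam]
  | succ n ih =>
    rw [quantizerGrid, radiusParam]
    refine Finset.mem_insert_of_mem (Finset.mem_image.2 ⟨_, ih, ?_⟩)
    rw [add_comm (radiusParam p q n), stretch_add κ (p (n + 1) + q n)]

theorem IsGridParam.radiusParam_pos {p q : ℕ → ℝ} (h : IsGridParam κ r p q) (n : ℕ) :
    0 < radiusParam p q n := by
  induction n with
  | zero => exact h.p_pos 0
  | succ n ih =>
    have := h.p_pos (n + 1)
    have := h.q_pos n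
    rw [radiusParam]
    linarith

theorem IsGridParam.le_radius {p q : ℕ → ℝ} (h : IsGridParam κ r p q) (n : ℕ) :
    ∀ y ∈ quantizerGrid κ p q n, y ≤ stretch κ (radiusParam p q n) := by
  induction n with
  | zero => simp [quantizerGrid, radiusParam]
  | succ n ih =>
    intro y hy
    rw [quantizerGrid, Finset.mem_insert, Finset.mem_image] at hy
    rw [radiusParam]
    rcases hy with rfl | ⟨t, ht, rfl⟩
    · have := h.radiusParam_pos n
      have := h.q_pos n
      exact (strictMono_stretch κ).monotone (by linarith)
    · rw [add_comm (radiusParam p q n), stretch_add κ (p (n + 1) + q n)]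
      have := ih t ht
      gcongr

theorem maximalRadius_eq {α : Finset ℝ} {b : ℝ} (hb : b ∈ α) (h0 : ∀ a ∈ α, 0 ≤ a)
    (hle : ∀ a ∈ α, a ≤ b) : maximalRadius α = b := by
  have h : (α.sup fun a => ‖a‖₊ : ℝ≥0) = ‖b‖₊ := by
    apply le_antisymm
    · refine Finset.sup_le fun a ha => ?_
      rw [← NNReal.coe_le_coe, coe_nnnorm, coe_nnnorm, Real.norm_of_nonneg (h0 a ha),
        Real.norm_of_nonneg (h0 b hb)]
      exact hle a ha
    · exact Finset.le_sup (f := fun a : ℝ => ‖a‖₊) hb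
  rw [maximalRadius, h, coe_nnnorm, Real.norm_of_nonneg (h0 b hb)]

theorem maximalRadius_grid {p q : ℕ → ℝ} (h : IsGridParam κ r p q) (hx₀ : 0 ≤ x₀) (hc : 0 < c)
    (n : ℕ) : maximalRadius ((quantizerGrid κ p q n).image fun t => x₀ + c * t) =
      x₀ + c * stretch κ (radiusParam p q n) := by
  refine maximalRadius_eq (Finset.mem_image_of_mem _ (radiusParam_mem p q n)) ?_ ?_
  · intro a ha
    obtain ⟨t, ht, rfl⟩ := Finset.mem_image.1 ha
    have := (stretch_pos (κ := κ) (h.p_pos n)).le.trans (h.stretch_le_of_mem n t ht)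
    positivity
  · intro a ha
    obtain ⟨t, ht, rfl⟩ := Finset.mem_image.1 ha
    have := h.le_radius n t ht
    gcongr

end Transfer

/-! ### Second-order expansions at `0`. -/

section Expansion

open scoped Topology

/-- `f s = 1 + a s + b s ^ 2 + O (s ^ 3)` for some `b`, as `s → 0`, `s ≠ 0`. -/
def HasQuadraticExpansion (f : ℝ → ℝ) (a : ℝ) : Prop :=
  ∃ b : ℝ, (fun s => f s - (1 + a * s + b * s ^ 2)) =O[𝓝[≠] 0] fun s => s ^ 3

theorem isBigO_pow_pow_of_le {m n : ℕ} (h : m ≤ n) :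
    (fun s : ℝ => s ^ n) =O[𝓝[≠] 0] fun s => s ^ m := by
  obtain ⟨k, rfl⟩ := Nat.exists_eq_add_of_le h
  have h1 : (fun s : ℝ => s ^ k) =O[𝓝[≠] 0] fun _ => (1 : ℝ) :=
    ((continuous_pow k).tendsto' 0 _ rfl |>.mono_left nhdsWithin_le_nhds).isBigO_one ℝ
  simpa [pow_add] using (isBigO_refl (fun s : ℝ => s ^ m) _).mul h1

namespace HasQuadraticExpansion

variable {f g : ℝ → ℝ} {a a' : ℝ}

theorem sub_linear (h : HasQuadraticExpansion f a) :
    (fun s => f s - (1 + a * s)) =O[𝓝[≠] 0] fun s => s ^ 2 := by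
  obtain ⟨b, hb⟩ := h
  have := (hb.trans (isBigO_pow_pow_of_le (show 2 ≤ 3 by norm_num))).add
    ((isBigO_refl (fun s : ℝ => s ^ 2) (𝓝[≠] 0)).const_mul_left b)
  exact this.congr_left fun s => by ring

theorem sub_one (h : HasQuadraticExpansion f a) :
    (fun s => f s - 1) =O[𝓝[≠] 0] fun s => s := by
  have h1 := h.sub_linear.trans (isBigO_pow_pow_of_le (show 1 ≤ 2 by norm_num))
  simp only [pow_one] at h1
  have := h1.add ((isBigO_refl (fun s : ℝ => s) (𝓝[≠] 0)).const_mul_left a)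
  exact this.congr_left fun s => by ring

theorem tendsto (h : HasQuadraticExpansion f a) : Tendsto f (𝓝[≠] 0) (𝓝 1) := by
  have h1 : Tendsto (fun s => f s - 1) (𝓝[≠] 0) (𝓝 0) :=
    h.sub_one.trans_tendsto (tendsto_id.mono_left nhdsWithin_le_nhds)
  simpa using h1.add_const 1

theorem mul (hf : HasQuadraticExpansion f a) (hg : HasQuadraticExpansion g a') :
    HasQuadraticExpansion (fun s => f s * g s) (a + a') := by
  have hg1 := hg.tendsto.isBigO_one ℝ
  obtain ⟨b, hb⟩ := hf
  obtain ⟨b', hb'⟩ := hg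
  refine ⟨b + b' + a * a', ?_⟩
  have hp : (fun s : ℝ => 1 + a * s + b * s ^ 2) =O[𝓝[≠] 0] fun _ => (1 : ℝ) :=
    ((by fun_prop : Continuous fun s : ℝ => 1 + a * s + b * s ^ 2).tendsto 0
      |>.mono_left nhdsWithin_le_nhds).isBigO_one ℝ
  have h3 := (isBigO_refl (fun s : ℝ => s ^ 3) (𝓝[≠] 0)).const_mul_left (a * b' + a' * b)
  have h4 := (isBigO_pow_pow_of_le (show 3 ≤ 4 by norm_num)).const_mul_left (b * b')
  have h12 := ((hb.mul hg1).add ((hp.mul hb').congr_right fun s => by ring)).add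
    ((h3.congr_right fun s => (mul_one _).symm).add (h4.congr_right fun s => (mul_one _).symm))
  exact (h12.congr_left fun s => by ring).congr_right fun s => by ring

theorem rpow (hf : HasQuadraticExpansion f a) (y : ℝ) :
    HasQuadraticExpansion (fun s => f s ^ y) (y * a) := by
  have hT := (Real.one_add_rpow_hasFPowerSeriesAt_zero (a := y)).isBigO_sub_partialSum_pow 3
  set k := Ring.choose y 2
  have hT' : (fun x : ℝ => (1 + x) ^ y - (1 + y * x + k * x ^ 2)) =O[𝓝 0] fun x => x ^ 3 := by
    refine (hT.trans ((isBigO_norm_left.2 (isBigO_refl (fun x : ℝ => x ^ 3) (𝓝 0))).congr_left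
      fun x => norm_pow x 3)).congr_left fun x => ?_
    simp only [zero_add, FormalMultilinearSeries.partialSum, Finset.sum_range_succ,
      Finset.sum_range_zero, binomialSeries_apply]
    simp [k, pow_two]
  have ht : Tendsto (fun s => f s - 1) (𝓝[≠] 0) (𝓝 0) := by
    simpa using hf.tendsto.sub_const 1
  have h1 := (hT'.comp_tendsto ht).trans (hf.sub_one.pow 3)
  -- Factored as a difference of squares: one factor is `O(s ^ 2)`, the other `O(s)`.
  have h2 : (fun s => (f s - 1) ^ 2 - a ^ 2 * s ^ 2) =O[𝓝[≠] 0] fun s => s ^ 3 := by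
    have hs : (fun s => (f s - 1) + a * s) =O[𝓝[≠] 0] fun s => s :=
      hf.sub_one.add ((isBigO_refl _ _).const_mul_left a)
    exact ((hf.sub_linear.mul hs).congr_left fun s => by ring).congr_right fun s => by ring
  obtain ⟨b, hb⟩ := hf
  refine ⟨y * b + k * a ^ 2, ?_⟩
  refine ((h1.add (hb.const_mul_left y)).add (h2.const_mul_left k)).congr_left fun s => ?_
  simp only [Function.comp]
  rw [add_sub_cancel]
  ring

theorem exp_mul (θ : ℝ) : HasQuadraticExpansion (fun s => Real.exp (θ * s)) θ := by
  refine ⟨θ ^ 2 / 2, ?_⟩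
  have ht : Tendsto (fun s : ℝ => θ * s) (𝓝[≠] 0) (𝓝 0) :=
    (Continuous.tendsto' (by fun_prop) _ _ (by simp)).mono_left nhdsWithin_le_nhds
  have h := (Real.exp_sub_sum_range_isBigO_pow 3).comp_tendsto ht
  refine (h.congr_left fun s => ?_).trans
    (((isBigO_refl (fun s : ℝ => s ^ 3) (𝓝[≠] 0)).const_mul_left (θ ^ 3)).congr_left fun s => ?_)
  · simp only [Function.comp, Finset.sum_range_succ, Finset.sum_range_zero]
    norm_num [Nat.factorial]
    ring
  · simp only [Function.comp]
    ring

theorem stretch_div (κ : ℝ) : HasQuadraticExpansion (fun s => stretch κ s / s) (κ / 2) := by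
  rcases eq_or_ne κ 0 with rfl | hκ
  · refine ⟨0, IsBigO.of_bound 0 ?_⟩
    filter_upwards [self_mem_nhdsWithin] with s hs
    have hs : s ≠ 0 := hs
    simp [stretch_zero_left, hs]
  refine ⟨κ ^ 2 / 6, ?_⟩
  have ht : Tendsto (fun s : ℝ => κ * s) (𝓝[≠] 0) (𝓝 0) :=
    (Continuous.tendsto' (by fun_prop) _ _ (by simp)).mono_left nhdsWithin_le_nhds
  -- One order more than the target, since the division by `s` costs one.
  have h := (Real.exp_sub_sum_range_isBigO_pow 4).comp_tendsto ht
  have h' : (fun s : ℝ => Real.exp (κ * s) -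
      (1 + κ * s + (κ * s) ^ 2 / 2 + (κ * s) ^ 3 / 6)) =O[𝓝[≠] 0] fun s => s ^ 4 := by
    refine (h.congr_left fun s => ?_).trans
      (((isBigO_refl (fun s : ℝ => s ^ 4) (𝓝[≠] 0)).const_mul_left (κ ^ 4)).congr_left fun s => ?_)
    · simp only [Function.comp, Finset.sum_range_succ, Finset.sum_range_zero]
      norm_num [Nat.factorial]
    · simp only [Function.comp]
      ring
  have h2 := (h'.mul (isBigO_refl (fun s : ℝ => s⁻¹) (𝓝[≠] 0))).const_mul_left κ⁻¹
  refine h2.congr' ?_ ?_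
  · filter_upwards [self_mem_nhdsWithin] with s hs
    have hs : s ≠ 0 := hs
    rw [← one_add_mul_stretch]
    field_simp
    ring
  · filter_upwards [self_mem_nhdsWithin] with s hs
    have hs : s ≠ 0 := hs
    field_simp

end HasQuadraticExpansion

variable {κ r : ℝ}

theorem stretch_div_pos {s : ℝ} (hs : s ≠ 0) : 0 < stretch κ s / s := by
  rcases hs.lt_or_gt with h | h
  · exact div_pos_of_neg_of_neg (by simpa using strictMono_stretch κ h) h
  · exact div_pos (stretch_pos h) h

theorem abs_stretch_rpow {s : ℝ} (hs : s ≠ 0) :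
    |stretch κ s| ^ r = |s| ^ r * (stretch κ s / s) ^ r := by
  rw [← Real.mul_rpow (abs_nonneg _) (stretch_div_pos hs).le, ← abs_of_pos (stretch_div_pos hs),
    ← abs_mul, mul_div_cancel₀ _ hs]

theorem hasQuadraticExpansion_integrand (κ r : ℝ) :
    HasQuadraticExpansion (fun s => Real.exp ((1 - κ * r) * s) * (stretch κ s / s) ^ r)
      ((1 - κ * r) + r * (κ / 2)) :=
  (HasQuadraticExpansion.exp_mul _).mul ((HasQuadraticExpansion.stretch_div κ).rpow r)

/-- The substitution `v = s u` turns the moment into an integral over `[0, 1]` of `u ^ r` times the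
expanded factor, with an error uniform in `u`. First order suffices, because `stretchBalance / |s| ^
r` contains this quotient with an additional factor `s`. -/
theorem stretchMoment_expansion (hr : 0 < r) :
    (fun s => stretchMoment κ r s / (s * |s| ^ r) -
      (1 / (r + 1) + ((1 - κ * r) + r * (κ / 2)) / (r + 2) * s)) =O[𝓝[≠] 0] fun s => s ^ 2 := by
  set y₁ := (1 - κ * r) + r * (κ / 2)
  obtain ⟨K, hK⟩ := (hasQuadraticExpansion_integrand κ r).sub_linear.bound
  refine IsBigO.of_bound |K| ?_
  rw [eventually_nhdsWithin_iff, Metric.eventually_nhds_iff] at hK ⊢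
  obtain ⟨δ, hδ, hK⟩ := hK
  refine ⟨δ, hδ, fun s hsδ hs => ?_⟩
  have hs : s ≠ 0 := hs
  have hsr : |s| ^ r ≠ 0 := (Real.rpow_pos_of_pos (abs_pos.2 hs) r).ne'
  have hF := (continuous_moment_integrand (κ := κ) hr)
  have h1 : stretchMoment κ r s / (s * |s| ^ r) = ∫ u in (0 : ℝ)..1,
      Real.exp ((1 - κ * r) * (s * u)) * |stretch κ (s * u)| ^ r / |s| ^ r := by
    rw [intervalIntegral.integral_div, stretchMoment]
    have := intervalIntegral.smul_integral_comp_mul_left (a := 0) (b := 1)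
      (fun v => Real.exp ((1 - κ * r) * v) * |stretch κ v| ^ r) s
    rw [mul_zero, mul_one, smul_eq_mul] at this
    rw [← this, mul_div_mul_left _ _ hs]
  have h2 : 1 / (r + 1) + y₁ / (r + 2) * s =
      ∫ u in (0 : ℝ)..1, (u ^ r + y₁ * s * u ^ (r + 1)) := by
    rw [intervalIntegral.integral_add (f := fun u : ℝ => u ^ r)
      (g := fun u : ℝ => y₁ * s * u ^ (r + 1)) ((Real.continuous_rpow_const hr.le).intervalIntegrable _ _)
      ((continuous_const.mul (Real.continuous_rpow_const (by linarith))).intervalIntegrable _ _),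
      intervalIntegral.integral_const_mul, integral_rpow (Or.inl (by linarith)),
      integral_rpow (Or.inl (by linarith))]
    rw [Real.one_rpow, Real.one_rpow, Real.zero_rpow (by linarith), Real.zero_rpow (by linarith),
      add_assoc r 1 1, one_add_one_eq_two]
    field_simp
    ring
  rw [h1, h2, ← intervalIntegral.integral_sub]
  · have := intervalIntegral.norm_integral_le_of_norm_le_const (a := (0 : ℝ)) (b := 1)
      (C := |K| * ‖s ^ 2‖) (f := fun u =>
        Real.exp ((1 - κ * r) * (s * u)) * |stretch κ (s * u)| ^ r / |s| ^ r -
          (u ^ r + y₁ * s * u ^ (r + 1))) ?_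
    · simpa using this
    · intro u hu
      rw [Set.uIoc_of_le zero_le_one] at hu
      have hsu : s * u ≠ 0 := mul_ne_zero hs hu.1.ne'
      have hb := hK (y := s * u) (by
        rw [dist_zero_right, norm_mul, Real.norm_of_nonneg hu.1.le]
        rw [dist_zero_right] at hsδ
        exact (mul_le_of_le_one_right (norm_nonneg _) hu.2).trans_lt hsδ) hsu
      have hu1 : u ^ r ≤ 1 := Real.rpow_le_one hu.1.le hu.2 hr.le
      have hu0 : 0 ≤ u ^ r := Real.rpow_nonneg hu.1.le r
      rw [abs_stretch_rpow hsu, abs_mul, abs_of_pos hu.1, Real.mul_rpow (abs_nonneg _) hu.1.le,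
        Real.rpow_add hu.1, Real.rpow_one]
      have he : Real.exp ((1 - κ * r) * (s * u)) *
          (|s| ^ r * u ^ r * (stretch κ (s * u) / (s * u)) ^ r) / |s| ^ r -
          (u ^ r + y₁ * s * (u ^ r * u)) =
          u ^ r * (Real.exp ((1 - κ * r) * (s * u)) * (stretch κ (s * u) / (s * u)) ^ r -
            (1 + y₁ * (s * u))) := by
        field_simp
      rw [he, norm_mul, Real.norm_of_nonneg hu0]
      have hsq : ‖(s * u) ^ 2‖ ≤ ‖s ^ 2‖ := by
        rw [mul_pow, norm_mul]
        refine mul_le_of_le_one_right (norm_nonneg _) ?_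
        rw [Real.norm_of_nonneg (by positivity)]
        exact pow_le_one₀ hu.1.le hu.2
      calc _ ≤ 1 * (K * ‖(s * u) ^ 2‖) := by gcongr
        _ ≤ |K| * ‖s ^ 2‖ := by
          rw [one_mul]
          gcongr
          exact le_abs_self K
  · exact ((hF.comp (continuous_const.mul continuous_id)).div_const _).intervalIntegrable _ _
  · exact ((Real.continuous_rpow_const hr.le).add
      (continuous_const.mul (Real.continuous_rpow_const (by linarith)))).intervalIntegrable _ _

theorem hasQuadraticExpansion_balance (hr : 0 < r) :
    HasQuadraticExpansion (fun s => stretchBalance κ r s / |s| ^ r)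
      ((1 - κ * r) + r * (κ / 2) - (1 - κ * r) / (r + 1)) := by
  obtain ⟨b, hb⟩ := hasQuadraticExpansion_integrand κ r
  set y₁ := (1 - κ * r) + r * (κ / 2)
  refine ⟨b - (1 - κ * r) * (y₁ / (r + 2)), ?_⟩
  have h := (((isBigO_refl (fun s : ℝ => s) (𝓝[≠] 0)).mul
    (stretchMoment_expansion (κ := κ) hr)).congr_right fun s =>
      (by ring : s * s ^ 2 = s ^ 3)).const_mul_left (1 - κ * r)
  refine (hb.sub h).congr' ?_ EventuallyEq.rfl
  filter_upwards [self_mem_nhdsWithin] with s hs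
  have hs : s ≠ 0 := hs
  have hsr : |s| ^ r ≠ 0 := (Real.rpow_pos_of_pos (abs_pos.2 hs) r).ne'
  rw [stretchBalance, abs_stretch_rpow hs]
  field_simp
  ring

/-- Two positive null sequences that are exchanged by an involution of the line. -/
theorem HasQuadraticExpansion.inv_sub_inv {f : ℝ → ℝ} {a : ℝ} (hf : HasQuadraticExpansion f a)
    {x y : ℕ → ℝ} (hx : ∀ n, 0 < x n) (hy : ∀ n, 0 < y n) (hx0 : Tendsto x atTop (𝓝 0))
    (hy0 : Tendsto y atTop (𝓝 0)) (h : ∀ n, f (x n) / x n = f (-y n) / y n) :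
    (fun n => 1 / x n - 1 / y n + 2 * a) =O[atTop] (fun n => y n ^ 2) ∧
      y =O[atTop] x := by
  obtain ⟨b, hb⟩ := hf
  obtain ⟨K, hK0, hK⟩ := hb.exists_pos
  have hK := hK.bound
  have hx' : Tendsto x atTop (𝓝[≠] 0) :=
    tendsto_nhdsWithin_iff.2 ⟨hx0, Eventually.of_forall fun n => (hx n).ne'⟩
  have hy' : Tendsto (fun n => -y n) atTop (𝓝[≠] 0) :=
    tendsto_nhdsWithin_iff.2 ⟨by simpa using hy0.neg,
      Eventually.of_forall fun n => (neg_neg_of_pos (hy n)).ne⟩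
  set M := 2 * |a| + 2 * |b| + 2 * K with hM
  have hM0 : 0 < M := by positivity
  have hsmall : ∀ᶠ n in atTop, x n ≤ 1 ∧ y n ≤ 1 ∧ M * x n ≤ 1 / 2 ∧ M * y n ≤ 1 / 2 := by
    have e1 := hx0.eventually (ge_mem_nhds (show (0 : ℝ) < 1 by norm_num))
    have e2 := hy0.eventually (ge_mem_nhds (show (0 : ℝ) < 1 by norm_num))
    have e3 := hx0.eventually (ge_mem_nhds (show (0 : ℝ) < 1 / 2 / M by positivity))
    have e4 := hy0.eventually (ge_mem_nhds (show (0 : ℝ) < 1 / 2 / M by positivity))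
    filter_upwards [e1, e2, e3, e4] with n h1 h2 h3 h4
    exact ⟨h1, h2, (le_div_iff₀' hM0).1 h3, (le_div_iff₀' hM0).1 h4⟩
  have hmain : ∀ᶠ n in atTop, |1 / x n - 1 / y n + 2 * a| ≤ (2 * |b| * M + 5 * K) * y n ^ 2 ∧
      y n ≤ 2 * x n := by
    filter_upwards [hsmall, hx'.eventually hK, hy'.eventually hK] with n hs h1 h2
    obtain ⟨hx1, hy1, hMx, hMy⟩ := hs
    have hxn := hx n
    have hyn := hy n
    set X := x n
    set Y := y n
    set e := f X - (1 + a * X + b * X ^ 2) with he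
    set e' := f (-Y) - (1 + a * -Y + b * (-Y) ^ 2) with he'
    -- The even coefficient `b` survives only through `Y - X`. A crude bound `M` on `|1 / X - 1 /
    -- Y|` yields `|Y - X| ≤ M X Y`, so this term is of second order as well.
    have hid : 1 / X - 1 / Y + 2 * a = b * (Y - X) + e' / Y - e / X := by
      have hn := h n
      have hfX : f X = e + (1 + a * X + b * X ^ 2) := by rw [he]; ring
      have hfY : f (-Y) = e' + (1 + a * -Y + b * (-Y) ^ 2) := by rw [he']; ring
      change f X / X = f (-Y) / Y at hn
      rw [hfX, hfY] at hn
      field_simp at hn ⊢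
      linarith
    have hek : |e / X| ≤ K * X ^ 2 := by
      rw [abs_div, abs_of_pos hxn, div_le_iff₀ hxn]
      rw [Real.norm_eq_abs, norm_pow, Real.norm_of_nonneg hxn.le] at h1
      linarith
    have hek' : |e' / Y| ≤ K * Y ^ 2 := by
      rw [abs_div, abs_of_pos hyn, div_le_iff₀ hyn]
      rw [Real.norm_eq_abs, norm_pow, norm_neg, Real.norm_of_nonneg hyn.le] at h2
      linarith
    have hbound : |1 / X - 1 / Y + 2 * a| ≤ |b| * |Y - X| + K * Y ^ 2 + K * X ^ 2 := by
      rw [hid, ← abs_mul]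
      have := abs_add_le (b * (Y - X)) (e' / Y)
      have := abs_sub (b * (Y - X) + e' / Y) (e / X)
      linarith
    have hYX : |Y - X| ≤ 1 := by rw [abs_le]; constructor <;> linarith
    have hinv : |1 / X - 1 / Y| ≤ M := by
      have h3 := abs_sub (1 / X - 1 / Y + 2 * a) (2 * a)
      rw [add_sub_cancel_right, abs_mul 2 a, abs_two] at h3
      have h4 : |b| * |Y - X| ≤ |b| := mul_le_of_le_one_right (abs_nonneg _) hYX
      have h5 : K * Y ^ 2 ≤ K := mul_le_of_le_one_right hK0.le (pow_le_one₀ hyn.le hy1)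
      have h6 : K * X ^ 2 ≤ K := mul_le_of_le_one_right hK0.le (pow_le_one₀ hxn.le hx1)
      have := abs_nonneg b
      linarith
    have hdiff : |Y - X| ≤ M * (X * Y) := by
      have : Y - X = (1 / X - 1 / Y) * (X * Y) := by field_simp
      rw [this, abs_mul, abs_of_pos (mul_pos hxn hyn)]
      gcongr
    have hXY : X ≤ 2 * Y := by
      have h3 := neg_abs_le (Y - X)
      have h4 : M * (X * Y) ≤ 1 / 2 * X := by
        rw [show M * (X * Y) = (M * Y) * X by ring]
        gcongr
      linarith
    have hYX2 : Y ≤ 2 * X := by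
      have h3 := le_abs_self (Y - X)
      have h4 : M * (X * Y) ≤ 1 / 2 * Y := by
        rw [← mul_assoc]
        gcongr
      linarith
    refine ⟨?_, hYX2⟩
    have h5 : |b| * |Y - X| ≤ |b| * (M * (2 * Y * Y)) := by
      refine mul_le_mul_of_nonneg_left (hdiff.trans ?_) (abs_nonneg _)
      gcongr
    have h6 : K * X ^ 2 ≤ K * (2 * Y) ^ 2 := by gcongr
    calc _ ≤ _ := hbound
      _ ≤ |b| * (M * (2 * Y * Y)) + K * Y ^ 2 + K * (2 * Y) ^ 2 := by linarith
      _ = _ := by ring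
  refine ⟨IsBigO.of_bound (2 * |b| * M + 5 * K) (hmain.mono fun n hn => ?_), IsBigO.of_bound 2
    (hmain.mono fun n hn => ?_)⟩
  · rw [Real.norm_eq_abs, Real.norm_of_nonneg (by positivity)]
    exact hn.1
  · rw [Real.norm_of_nonneg (hx n).le, Real.norm_of_nonneg (hy n).le]
    exact hn.2

end Expansion

/-! ### Sequences whose inverses grow almost linearly. -/

section Sequences

open scoped Topology

/-- The increments are dominated by those of a multiple of `1 / n`, so the sum telescopes: the
sequence is Cauchy and its distance to the limit is `O(1 / n)`. -/
theorem exists_sub_isBigO_one_div {u : ℕ → ℝ}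
    (h : (fun n => u (n + 1) - u n) =O[atTop] fun n : ℕ => 1 / (n : ℝ) ^ 2) :
    ∃ C, (fun n => u n - C) =O[atTop] fun n : ℕ => 1 / (n : ℝ) := by
  obtain ⟨K, hK0, hK⟩ := h.exists_pos
  obtain ⟨N, hN⟩ := eventually_atTop.1 (hK.bound.and (eventually_ge_atTop 1))
  have hstep : ∀ n, N ≤ n → ∀ m, n ≤ m →
      |u m - u n| ≤ 2 * K * (1 / (n : ℝ) - 1 / (m : ℝ)) := by
    intro n hn m hm
    induction m, hm using Nat.le_induction with
    | base => simp
    | succ m hm ih =>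
      obtain ⟨h1, hm1⟩ := hN m (hn.trans hm)
      have hm0 : (1 : ℝ) ≤ m := by exact_mod_cast hm1
      rw [Real.norm_eq_abs, Real.norm_of_nonneg (by positivity)] at h1
      have h2 : 1 / (m : ℝ) ^ 2 ≤ 2 * (1 / (m : ℝ) - 1 / ((m : ℝ) + 1)) := by
        have : 2 * (1 / (m : ℝ) - 1 / ((m : ℝ) + 1)) = 2 / (m * (m + 1)) := by
          field_simp
          ring
        rw [this, div_le_div_iff₀ (by positivity) (by positivity)]
        nlinarith
      have h3 := abs_add_le (u (m + 1) - u m) (u m - u n)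
      rw [sub_add_sub_cancel] at h3
      push_cast
      have h4 := mul_le_mul_of_nonneg_left h2 hK0.le
      linarith
  have hbd : ∀ n, N ≤ n → ∀ m, n ≤ m → |u m - u n| ≤ 2 * K * (1 / (n : ℝ)) := by
    intro n hn m hm
    refine (hstep n hn m hm).trans ?_
    have : 0 ≤ 1 / (m : ℝ) := by positivity
    gcongr
    linarith
  have hlim : Tendsto (fun n : ℕ => 2 * K * (1 / (n : ℝ))) atTop (𝓝 0) := by
    simpa using tendsto_one_div_atTop_nhds_zero_nat.const_mul (2 * K)
  have hcau : CauchySeq u := by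
    rw [Metric.cauchySeq_iff']
    intro ε hε
    obtain ⟨n, hn1, hn2⟩ :=
      ((hlim.eventually (gt_mem_nhds hε)).and (eventually_ge_atTop N)).exists
    exact ⟨n, fun m hm => (hbd n hn2 m hm).trans_lt hn1⟩
  obtain ⟨C, hC⟩ := cauchySeq_tendsto_of_complete hcau
  refine ⟨C, IsBigO.of_bound (2 * K) ?_⟩
  filter_upwards [eventually_ge_atTop N] with n hn
  rw [Real.norm_eq_abs, abs_sub_comm, Real.norm_of_nonneg (by positivity)]
  exact le_of_tendsto ((hC.sub_const (u n)).abs)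
    ((eventually_ge_atTop n).mono fun m hm => hbd n hn m hm)

/-- The increments of `1 / x` tend to `c`, hence eventually exceed `c / 2`, and `1 / x` grows at
least linearly. -/
theorem isBigO_one_div_of_inv_step {x : ℕ → ℝ} {c : ℝ} (hc : 0 < c) (hx : ∀ n, 0 < x n)
    (hx0 : Tendsto x atTop (𝓝 0))
    (h : (fun n => 1 / x (n + 1) - 1 / x n - c) =O[atTop] fun n => x n ^ 2) :
    x =O[atTop] fun n : ℕ => 1 / (n : ℝ) := by
  have hlim : Tendsto (fun n => 1 / x (n + 1) - 1 / x n - c) atTop (𝓝 0) :=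
    h.trans_tendsto (by simpa using hx0.pow 2)
  have hev := hlim.eventually (lt_mem_nhds (show -(c / 2) < 0 by linarith))
  obtain ⟨N, hN⟩ := eventually_atTop.1 hev
  have hgrow : ∀ m, N ≤ m → c / 2 * ((m : ℝ) - N) ≤ 1 / x m := by
    intro m hm
    induction m, hm using Nat.le_induction with
    | base => simpa using (hx N).le
    | succ m hm ih =>
      have := hN m hm
      push_cast
      linarith
  refine IsBigO.of_bound (4 / c) ?_
  filter_upwards [eventually_ge_atTop (2 * N), eventually_ge_atTop 1] with n hn hn1
  have h1 := hgrow n (by omega)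
  have hn' : 2 * (N : ℝ) ≤ n := by exact_mod_cast hn
  have hn0 : (0 : ℝ) < n := by exact_mod_cast hn1
  have h2 : c / 4 * n ≤ 1 / x n := by nlinarith
  rw [Real.norm_of_nonneg (hx n).le, Real.norm_of_nonneg (by positivity)]
  rw [le_div_iff₀ (hx n)] at h2
  rw [div_mul_div_comm, mul_one, le_div_iff₀ (by positivity)]
  linarith

/-- The bound `x = O(1 / n)` makes the error in the increments summable, so `1 / x n = c n + O(1)`;
inverting gives the claim. -/
theorem sub_one_div_isBigO_of_inv_step {x : ℕ → ℝ} {c : ℝ} (hc : 0 < c) (hx : ∀ n, 0 < x n)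
    (hx0 : Tendsto x atTop (𝓝 0))
    (h : (fun n => 1 / x (n + 1) - 1 / x n - c) =O[atTop] fun n => x n ^ 2) :
    (fun n : ℕ => x n - 1 / (c * n)) =O[atTop] fun n : ℕ => 1 / (n : ℝ) ^ 2 := by
  have hO := isBigO_one_div_of_inv_step hc hx hx0 h
  obtain ⟨C, hC⟩ := exists_sub_isBigO_one_div (u := fun n => 1 / x n - c * n) <| by
    refine ((h.trans (hO.pow 2)).congr_left fun n => ?_).congr_right fun n => ?_
    · push_cast
      ring
    · rw [div_pow, one_pow]
  have hw : (fun n : ℕ => 1 / x n - c * n) =O[atTop] fun _ => (1 : ℝ) := by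
    have h1 : (fun n : ℕ => 1 / (n : ℝ)) =O[atTop] fun _ => (1 : ℝ) :=
      tendsto_one_div_atTop_nhds_zero_nat.isBigO_one ℝ
    exact ((hC.trans h1).add (isBigO_const_const C one_ne_zero _)).congr_left fun n => by ring
  have hmul := ((hw.mul hO).mul (isBigO_refl (fun n : ℕ => 1 / (n : ℝ)) atTop)).const_mul_left
    (-(1 / c))
  refine hmul.congr' ?_ ?_
  · filter_upwards [eventually_ge_atTop 1] with n hn
    have hn0 : (n : ℝ) ≠ 0 := by positivity
    have := (hx n).ne'
    field_simp
    ring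
  · filter_upwards with n
    ring

end Sequences

/-! ### Asymptotics of the grid parameters. -/

section Radius

open scoped Topology

variable {κ r : ℝ} {p q : ℕ → ℝ}

namespace IsGridParam

theorem q_succ_lt (h : IsGridParam κ r p q) (hr : 0 < r) (hκr : κ * r < 1) (n : ℕ) :
    q (n + 1) < q n := by
  have h1 := strictMono_stretch κ (h.p_succ_lt hr hκr n)
  rw [← h.link, ← h.link] at h1
  have := (strictMono_stretch κ).lt_iff_lt.1 (neg_lt_neg_iff.1 h1)
  linarith

/-- Monotone limits `x`, `y` exist and solve the limiting equations; positive ones would give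
`stretch κ x ^ r < stretchBalance κ r x = stretchBalance κ r (-y) < stretch κ x ^ r`. -/
theorem tendsto_zero (h : IsGridParam κ r p q) (hr : 0 < r) (hκr : κ * r < 1) :
    Tendsto p atTop (𝓝 0) ∧ Tendsto q atTop (𝓝 0) := by
  have hp := tendsto_atTop_ciInf (antitone_nat_of_succ_le fun n => (h.p_succ_lt hr hκr n).le)
    ⟨0, by rintro _ ⟨n, rfl⟩; exact (h.p_pos n).le⟩
  have hq := tendsto_atTop_ciInf (antitone_nat_of_succ_le fun n => (h.q_succ_lt hr hκr n).le)
    ⟨0, by rintro _ ⟨n, rfl⟩; exact (h.q_pos n).le⟩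
  set x := ⨅ n, p n
  set y := ⨅ n, q n
  have hx : 0 ≤ x := ge_of_tendsto' hp fun n => (h.p_pos n).le
  have hy : 0 ≤ y := ge_of_tendsto' hq fun n => (h.q_pos n).le
  have hlink : -stretch κ (-y) = stretch κ x := by
    refine tendsto_nhds_unique (((continuous_stretch κ).tendsto _ |>.comp hq.neg).neg) ?_
    refine ((continuous_stretch κ).tendsto x |>.comp hp).congr fun n => ?_
    exact (h.link n).symm
  have hstep : stretchBalance κ r x = stretchBalance κ r (-y) := by
    refine tendsto_nhds_unique ((continuous_stretchBalance hr).tendsto x |>.comp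
      ((tendsto_add_atTop_iff_nat 1).2 hp)) ?_
    refine ((continuous_stretchBalance hr).tendsto _ |>.comp hq.neg).congr fun n => ?_
    exact (h.step n).symm
  have hx0 : x = 0 := by
    by_contra hne
    have hxpos : 0 < x := lt_of_le_of_ne hx (Ne.symm hne)
    have hypos : 0 < y := by
      refine lt_of_le_of_ne hy fun h0 => ?_
      rw [← h0, neg_zero, stretch_zero, neg_zero] at hlink
      exact (stretch_pos hxpos).ne hlink
    have h1 := rpow_lt_stretchBalance (κ := κ) hr hκr hxpos
    have h2 := stretchBalance_neg_lt (κ := κ) hr hκr hypos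
    rw [hlink, ← hstep] at h2
    linarith
  have hy0 : y = 0 := by
    rw [hx0, stretch_zero, neg_eq_zero] at hlink
    have := (strictMono_stretch κ).injective (hlink.trans (stretch_zero κ).symm)
    linarith
  exact ⟨hx0 ▸ hp, hy0 ▸ hq⟩

/-- The `link` equation is `f (p n) / p n = f (-q n) / q n` for `f s = s / stretch κ s`, whose
linear coefficient is `-κ / 2`. -/
theorem inv_p_sub_inv_q (h : IsGridParam κ r p q) (hr : 0 < r) (hκr : κ * r < 1) :
    (fun n => 1 / p n - 1 / q n - κ) =O[atTop] (fun n => q n ^ 2) ∧ q =O[atTop] p := by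
  have h0 := h.tendsto_zero hr hκr
  have hf := (HasQuadraticExpansion.stretch_div κ).rpow (-1)
  have := hf.inv_sub_inv h.p_pos h.q_pos h0.1 h0.2 fun n => by
    have h1 := (stretch_pos (κ := κ) (h.p_pos n)).ne'
    have h2 : stretch κ (-q n) ≠ 0 := by
      rw [← neg_ne_zero, h.link]
      exact h1
    have h3 := (h.p_pos n).ne'
    have h4 := (h.q_pos n).ne'
    have h5 := h.link n
    rw [Real.rpow_neg_one, Real.rpow_neg_one]
    field_simp
    linarith
  exact ⟨this.1.congr_left fun n => by ring, this.2⟩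

/-- The `step` equation, raised to the power `-1 / r`, takes the same form with `f s =
(stretchBalance κ r s / |s| ^ r) ^ (-1 / r)`. -/
theorem inv_p_succ_sub_inv_q (h : IsGridParam κ r p q) (hr : 0 < r) (hκr : κ * r < 1) :
    (fun n => 1 / p (n + 1) - 1 / q n - (2 * (1 - κ * r) / (r + 1) + κ)) =O[atTop]
      (fun n => q n ^ 2) := by
  have h0 := h.tendsto_zero hr hκr
  have hf := (hasQuadraticExpansion_balance (κ := κ) hr).rpow (-(1 / r))
  have hrr : r * -(1 / r) = -1 := by field_simp
  have := hf.inv_sub_inv (fun n => h.p_pos (n + 1)) h.q_pos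
    ((tendsto_add_atTop_iff_nat 1).2 h0.1) h0.2 fun n => by
    have hb := (h.step n)
    have hb0 := (stretchBalance_neg_pos (κ := κ) hr hκr (h.q_pos n)).le
    have hp := h.p_pos (n + 1)
    have hq := h.q_pos n
    rw [abs_neg, abs_of_pos hp, abs_of_pos hq, hb, Real.div_rpow hb0 (Real.rpow_nonneg hp.le _),
      Real.div_rpow hb0 (Real.rpow_nonneg hq.le _), ← Real.rpow_mul hp.le, ← Real.rpow_mul hq.le,
      hrr, Real.rpow_neg_one, Real.rpow_neg_one]
    field_simp
  refine this.1.congr_left fun n => ?_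
  field_simp
  ring

theorem inv_p_step (h : IsGridParam κ r p q) (hr : 0 < r) (hκr : κ * r < 1) :
    (fun n => 1 / p (n + 1) - 1 / p n - 2 * (1 - κ * r) / (r + 1)) =O[atTop]
      (fun n => p n ^ 2) := by
  obtain ⟨h1, h2⟩ := h.inv_p_sub_inv_q hr hκr
  exact (((h.inv_p_succ_sub_inv_q hr hκr).sub h1).congr_left fun n => by ring).trans (h2.pow 2)

/-- The parameter of the largest point of the optimal grid with `n + 1` points. -/
theorem radiusParam_asymptotics (h : IsGridParam κ r p q) (hr : 0 < r) (hκr : κ * r < 1) :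
    ∃ C, (fun n : ℕ => radiusParam p q n -
      (r + 1) / (1 - κ * r) * Real.log ((n : ℝ) + 1) - C) =O[atTop] fun n : ℕ => 1 / (n : ℝ) := by
  -- The increment `p (n + 1) + q n` is `2 / (c n) + O(1 / n ^ 2)`, and `2 / c = (r + 1) / (1 - κ
  -- r)` is the coefficient of the logarithm.
  apply exists_sub_isBigO_one_div
  set c := 2 * (1 - κ * r) / (r + 1) with hcdef
  have hθ : 0 < 1 - κ * r := by linarith
  have hc : 0 < c := by positivity
  have hrc : (r + 1) / (1 - κ * r) = 2 / c := by rw [hcdef]; field_simp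
  have h0 := h.tendsto_zero hr hκr
  obtain ⟨hpq, hqp⟩ := h.inv_p_sub_inv_q hr hκr
  have hstep := h.inv_p_step hr hκr
  have hpO := isBigO_one_div_of_inv_step hc h.p_pos h0.1 hstep
  have hp := sub_one_div_isBigO_of_inv_step hc h.p_pos h0.1 hstep
  have hp2 : (fun n => p n ^ 2) =O[atTop] fun n : ℕ => 1 / (n : ℝ) ^ 2 :=
    (hpO.pow 2).congr_right fun n => by rw [div_pow, one_pow]
  have hb1 : (fun n => 1 / p n - 1 / q n) =O[atTop] fun _ => (1 : ℝ) := by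
    have h1 : (fun n => q n ^ 2) =O[atTop] fun _ => (1 : ℝ) :=
      (by simpa using h0.2.pow 2 : Tendsto (fun n => q n ^ 2) atTop (𝓝 0)).isBigO_one ℝ
    exact ((hpq.trans h1).add (isBigO_const_const κ one_ne_zero _)).congr_left fun n => by ring
  have hqp' : (fun n => q n - p n) =O[atTop] fun n : ℕ => 1 / (n : ℝ) ^ 2 := by
    have h1 := hb1.mul (((isBigO_refl p atTop).mul hqp))
    refine ((h1.congr_left fun n => ?_).congr_right fun n => ?_).trans hp2
    · have := (h.p_pos n).ne'
      have := (h.q_pos n).ne'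
      field_simp
    · ring
  have hb2 : (fun n => 1 / p (n + 1) - 1 / p n) =O[atTop] fun _ => (1 : ℝ) := by
    have h1 : (fun n => p n ^ 2) =O[atTop] fun _ => (1 : ℝ) :=
      (by simpa using h0.1.pow 2 : Tendsto (fun n => p n ^ 2) atTop (𝓝 0)).isBigO_one ℝ
    exact ((hstep.trans h1).add (isBigO_const_const c one_ne_zero _)).congr_left fun n => by ring
  have hpp : (fun n => p (n + 1) - p n) =O[atTop] fun n : ℕ => 1 / (n : ℝ) ^ 2 := by
    have hle : (fun n => p (n + 1)) =O[atTop] p := IsBigO.of_norm_le fun n => by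
      rw [Real.norm_of_nonneg (h.p_pos _).le]
      exact (h.p_succ_lt hr hκr n).le
    have h1 := (hb2.mul (((isBigO_refl p atTop).mul hle))).neg_left
    refine ((h1.congr_left fun n => ?_).congr_right fun n => ?_).trans hp2
    · have := (h.p_pos n).ne'
      have := (h.p_pos (n + 1)).ne'
      field_simp
      ring
    · ring
  have hlog : (fun n : ℕ => Real.log ((n : ℝ) + 1 + 1) - Real.log ((n : ℝ) + 1) - 1 / (n : ℝ))
      =O[atTop] fun n : ℕ => 1 / (n : ℝ) ^ 2 := by
    refine IsBigO.of_bound 2 ?_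
    filter_upwards [eventually_ge_atTop 1] with n hn
    have hn0 : (0 : ℝ) < n := by exact_mod_cast hn
    rw [← Real.log_div (by positivity) (by positivity), Real.norm_eq_abs,
      Real.norm_of_nonneg (by positivity)]
    have h1 := Real.log_le_sub_one_of_pos (show 0 < ((n : ℝ) + 1 + 1) / ((n : ℝ) + 1) by positivity)
    have h2 := Real.one_sub_inv_le_log_of_pos
      (show 0 < ((n : ℝ) + 1 + 1) / ((n : ℝ) + 1) by positivity)
    have h3 : ((n : ℝ) + 1 + 1) / ((n : ℝ) + 1) - 1 ≤ 1 / n := by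
      have : ((n : ℝ) + 1 + 1) / ((n : ℝ) + 1) - 1 = 1 / (n + 1) := by field_simp; ring
      rw [this]
      gcongr
      linarith
    have h4 : 1 / (n : ℝ) - 2 * (1 / (n : ℝ) ^ 2) ≤ 1 - (((n : ℝ) + 1 + 1) / ((n : ℝ) + 1))⁻¹ := by
      have e1 : 1 - (((n : ℝ) + 1 + 1) / ((n : ℝ) + 1))⁻¹ = 1 / (n + 2) := by field_simp; ring
      have e2 : 1 / (n : ℝ) - 2 * (1 / (n : ℝ) ^ 2) = (n - 2) / n ^ 2 := by field_simp
      rw [e1, e2, div_le_div_iff₀ (by positivity) (by positivity)]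
      nlinarith
    have h5 : 0 ≤ 2 * (1 / (n : ℝ) ^ 2) := by positivity
    rw [abs_le]
    constructor <;> linarith
  have hsum := ((hpp.add hqp').add (hp.const_mul_left 2)).sub (hlog.const_mul_left (2 / c))
  refine hsum.congr_left fun n => ?_
  rw [hrc, radiusParam]
  push_cast
  field_simp
  ring

theorem radiusParam_pred_asymptotics (h : IsGridParam κ r p q) (hr : 0 < r) (hκr : κ * r < 1) :
    ∃ C, (fun n : ℕ => radiusParam p q (n - 1) -
      ((r + 1) / (1 - κ * r) * Real.log n + C)) =O[atTop] fun n : ℕ => 1 / (n : ℝ) := by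
  obtain ⟨C, hC⟩ := h.radiusParam_asymptotics hr hκr
  refine ⟨C, ?_⟩
  have h1 := hC.comp_tendsto (tendsto_sub_atTop_nat 1)
  refine (h1.congr' ?_ EventuallyEq.rfl).trans (IsBigO.of_bound 2 ?_)
  · filter_upwards [eventually_ge_atTop 1] with n hn
    simp only [Function.comp, Nat.cast_sub hn, Nat.cast_one, sub_add_cancel]
    ring
  · filter_upwards [eventually_ge_atTop 2] with n hn
    have hn2 : (2 : ℝ) ≤ n := by exact_mod_cast hn
    simp only [Function.comp, Nat.cast_sub (show 1 ≤ n by omega), Nat.cast_one]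
    rw [Real.norm_of_nonneg (one_div_nonneg.2 (by linarith)),
      Real.norm_of_nonneg (by positivity), mul_one_div,
      div_le_div_iff₀ (by linarith) (by linarith)]
    linarith

end IsGridParam

end Radius

/-! ### Conclusion for the optimal quantizers. -/

section Optimal

variable {κ r x₀ c : ℝ} {P : Measure ℝ} {p q : ℕ → ℝ}

theorem existsUnique_isOptimalQuantizer (hP : IsStretchLaw κ x₀ c P) (hκ : 0 ≤ κ) (hr : 0 < r)
    (hκr : κ * r < 1) (hc : 0 < c) (h : IsGridParam κ r p q) {n : ℕ} (hn : 1 ≤ n) :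
    ∃! α : Finset ℝ, IsOptimalQuantizer r P n α := by
  obtain ⟨m, rfl⟩ := Nat.exists_eq_add_of_le' hn
  simp only [isOptimalQuantizer_iff hP hκ hr hκr hc h]
  exact existsUnique_eq

theorem IsOptimalQuantizer.maximalRadius_eq (hP : IsStretchLaw κ x₀ c P) (hκ : 0 ≤ κ)
    (hr : 0 < r) (hκr : κ * r < 1) (hx₀ : 0 ≤ x₀) (hc : 0 < c) (h : IsGridParam κ r p q) {n : ℕ}
    (hn : 1 ≤ n) {α : Finset ℝ} (hα : IsOptimalQuantizer r P n α) :
    maximalRadius α = x₀ + c * stretch κ (radiusParam p q (n - 1)) := by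
  obtain ⟨m, rfl⟩ := Nat.exists_eq_add_of_le' hn
  rw [(isOptimalQuantizer_iff hP hκ hr hκr hc h m α).1 hα, maximalRadius_grid h hx₀ hc,
    Nat.add_sub_cancel]

end Optimal

theorem mainTheorem10 (r : ℝ) (hr : 0 < r) :
    (∃ C : ℝ, ∀ lam : ℝ, 0 < lam →
      (∀ n : ℕ, 1 ≤ n → ∃! α : Finset ℝ, IsOptimalQuantizer r (expMeasure lam) n α) ∧
      ∀ α : ℕ → Finset ℝ,
        (∀ n : ℕ, 1 ≤ n → IsOptimalQuantizer r (expMeasure lam) n (α n)) →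
        (fun n : ℕ => maximalRadius (α n) - ((r + 1) / lam * Real.log (n : ℝ) + C / lam))
          =O[atTop] fun n : ℕ => 1 / (n : ℝ)) ∧
    (∀ γ : ℝ, r < γ → ∃ C : ℝ,
      (∀ n : ℕ, 1 ≤ n → ∃! α : Finset ℝ, IsOptimalQuantizer r (paretoMeasure 1 γ) n α) ∧
      ∀ α : ℕ → Finset ℝ,
        (∀ n : ℕ, 1 ≤ n → IsOptimalQuantizer r (paretoMeasure 1 γ) n (α n)) →
        (fun n : ℕ => Real.log (maximalRadius (α n)) - ((r + 1) / (γ - r) * Real.log (n : ℝ) + C))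
          =O[atTop] fun n : ℕ => 1 / (n : ℝ)) := by
  constructor
  · have hr0 : 0 * r < 1 := by simp
    -- The parameters are fixed before `lam`, which enters only as a scale; hence `C` depends on `r`
    -- alone.
    obtain ⟨p, q, h⟩ := exists_isGridParam le_rfl hr hr0
    obtain ⟨C, hC⟩ := h.radiusParam_pred_asymptotics hr hr0
    refine ⟨C, fun lam hlam => ?_⟩
    have hP := isStretchLaw_expMeasure hlam
    have hc : 0 < 1 / lam := by positivity
    refine ⟨fun n hn => existsUnique_isOptimalQuantizer hP le_rfl hr hr0 hc h hn, fun α hα => ?_⟩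
    refine (hC.const_mul_left (1 / lam)).congr' ?_ EventuallyEq.rfl
    filter_upwards [eventually_ge_atTop 1] with n hn
    rw [(hα n hn).maximalRadius_eq hP le_rfl hr hr0 le_rfl hc h hn, stretch_zero_left, zero_mul,
      sub_zero, div_one]
    ring
  · intro γ hγ
    have hγ0 : 0 < γ := hr.trans hγ
    have hκ : 0 < 1 / γ := by positivity
    -- The moment condition `r < γ` is what `κ * r < 1` means for the Pareto law.
    have hκr : 1 / γ * r < 1 := by
      rw [one_div_mul_eq_div, div_lt_one hγ0]
      exact hγ
    obtain ⟨p, q, h⟩ := exists_isGridParam hκ.le hr hκr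
    obtain ⟨C, hC⟩ := h.radiusParam_pred_asymptotics hr hκr
    have hP := isStretchLaw_paretoMeasure hγ0
    refine ⟨C / γ, fun n hn => existsUnique_isOptimalQuantizer hP hκ.le hr hκr hκ h hn,
      fun α hα => ?_⟩
    refine (hC.const_mul_left (1 / γ)).congr' ?_ EventuallyEq.rfl
    filter_upwards [eventually_ge_atTop 1] with n hn
    rw [(hα n hn).maximalRadius_eq hP hκ.le hr hκr zero_le_one hκ h hn, one_add_mul_stretch,
      Real.log_exp]
    have h1 : γ - r ≠ 0 := by linarith
    have h2 : (r + 1) / (1 - 1 / γ * r) = γ * ((r + 1) / (γ - r)) := by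
      have : 1 - 1 / γ * r = (γ - r) / γ := by field_simp
      rw [this]
      field_simp
    rw [h2]
    field_simp
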